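/- **Setting.** Let $\mathcal X$ and $\Omega$ be finite non-empty sets, $k$ a positive (semi)definite kernel on $\mathcal X\times\Omega$ with $k(z,z)\le 1$ for all $z$, and $\sigma_{\rm noise}^2>0$. Let $f$ be a sample path of the Gaussian process with mean zero and covariance function $k$, let $\varepsilon_1,\varepsilon_2,\dots\sim N(0,\sigma^2_{\rm noise})$ and $\xi_1,\xi_2,\dots\sim\chi^2_2$, where $f,\varepsilon_1,\varepsilon_2,\dots,\xi_1,\xi_2,\dots$ are mutually independent, and put $\beta_t=2\log|\mathcal X\times\Omega|+\xi_t$. Let $\rho$ be a (measurable) map from functions on $\Omega$ to $\mathbb R$ (a robustness measure), and $F(x)=\rho(f(x,\cdot))$. Observations are $y_t=f(x_t,w_t)+\varepsilon_t$. Given $t$ observations, let $K_t=(k((x_i,w_i),(x_j,w_j)))_{i,j\le t}$, $k_t(z)=(k(z,(x_j,w_j)))_{j\le t}$, and $$\mu_t(z)=k_t(z)^\top(K_t+\sigma^2_{\rm noise}I_t)^{-1}(y_1,\dots,y_t)^\top,\qquad \sigma_t^2(z)=k(z,z)-k_t(z)^\top(K_t+\sigma^2_{\rm noise}I_t)^{-1}k_t(z).$$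 Let ${\rm lcb}_{t-1}(x)\le{\rm ucb}_{t-1}(x)$ be such that, for every $t\ge1$ and $x\in\mathcal X$, ${\rm lcb}_{t-1}(x)\le\rho(g)\le{\rm ucb}_{t-1}(x)$ for every $g:\Omega\to\mathbb R$ with $|g(w)-\mu_{t-1}(x,w)|\le\beta_t^{1/2}\sigma_{t-1}(x,w)$ for all $w\in\Omega$ (almost surely). **Algorithm (RRGP-UCB, simulator setting).** For $t=1,2,\dots$ choose $$\hat x_t\in\arg\max_{x\in\mathcal X}\rho(\mu_{t-1}(x,\cdot)),\qquad \tilde x_t\in\arg\max_{x\in\mathcal X}\Bigl({\rm ucb}_{t-1}(x)-\max_{x'\in\mathcal X}{\rm lcb}_{t-1}(x')\Bigr)_+,$$ $$x_t\in\arg\max_{x\in\{\tilde x_t,\hat x_t\}}\bigl({\rm ucb}_{t-1}(x)-{\rm lcb}_{t-1}(x)\bigr),\qquad w_t\in\arg\max_{w\in\Omega}\sigma^2_{t-1}(x_t,w),$$ where $\hat x_t$ is a function of the earlier data $(x_i,w_i,y_i,\beta_i)_{i<t}$, and $x_t,w_t$ are functions of the earlier data and $\beta_t$; ties are broken arbitrarily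 subject to this. Let $$R_t=\sum_{i=1}^t\Bigl(\max_{x\in\mathcal X}F(x)-F(\hat x_i)\Bigr),\qquad \gamma_t=\frac12\sup_{z_1,\dots,z_t\in\mathcal X\times\Omega}\log\det\bigl(I_t+\sigma_{\rm noise}^{-2}(k(z_i,z_j))_{i,j\le t}\bigr).$$ **Theorem.** Let $q(a)=\sum_{i=1}^n\zeta_i h_i\bigl(\sum_{j=1}^{s_i}\lambda_{ij}a^{\nu_{ij}}\bigr)$, where $\zeta_i,\lambda_{ij}\ge0$, $\nu_{ij}>0$, and each $h_i:[0,\infty)\to[0,\infty)$ is non-decreasing and concave with $h_i(0)=0$. Assume that for all $t\ge1$, almost surely, $${\rm ucb}_{t-1}(x_t)-{\rm lcb}_{t-1}(x_t)\le q\Bigl(2\beta_t^{1/2}\max_{w\in\Omega}\sigma_{t-1}(x_t,w)\Bigr).$$ Then, for every $t\ge1$, $R_t$ is integrable and $$\mathbb E[R_t]\le 2t\sum_{i=1}^n\zeta_i h_i\Bigl(\frac1t\sum_{j=1}^{s_i}2^{\nu_{ij}}\lambda_{ij}\,(t\,C_{2,\nu_{ij}})^{1-\nu'_{ij}/2}(C_1\gamma_t)^{\nu'_{ij}/2}\Bigr),$$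 where $\nu'_{ij}=\min\{\nu_{ij},1\}$, $C_1=2/\log(1+\sigma_{\rm noise}^{-2})$ and $C_{2,\nu_{ij}}=\mathbb E[\beta_t^{\nu_{ij}/(2-\nu'_{ij})}]$. The expectation is over all sources of randomness ($f$, the noise, and the $\beta$'s). -/

import Mathlib

open MeasureTheory ProbabilityTheory
open scoped NNReal Matrix

namespace RRGPUCB

noncomputable section

/-! ### Gaussian process model -/

/-- The matrix with entries `k (z i) (z j)`. -/
def kernelMatrix {D : Type*} (k : D → D → ℝ) {n : ℕ} (z : Fin n → D) :
    Matrix (Fin n) (Fin n) ℝ :=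
  Matrix.of fun i j => k (z i) (z j)

/-- The vector with entries `k p (z i)`. -/
def kernelVec {D : Type*} (k : D → D → ℝ) {n : ℕ} (z : Fin n → D) (p : D) : Fin n → ℝ :=
  fun i => k p (z i)

/-- Posterior mean at `p` of a centred GP with kernel `k`, given observations `y i` at `z i` with
Gaussian noise of variance `v`: `k(p)ᵀ (K + v I)⁻¹ y`. -/
def postMean {D : Type*} (k : D → D → ℝ) (v : ℝ) {n : ℕ} (z : Fin n → D) (y : Fin n → ℝ)
    (p : D) : ℝ :=
  kernelVec k z p ⬝ᵥ ((kernelMatrix k z + v • (1 : Matrix (Fin n) (Fin n) ℝ))⁻¹ *ᵥ y)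

/-- Posterior variance at `p`: `k(p,p) - k(p)ᵀ (K + v I)⁻¹ k(p)`. -/
def postVar {D : Type*} (k : D → D → ℝ) (v : ℝ) {n : ℕ} (z : Fin n → D) (p : D) : ℝ :=
  k p p - kernelVec k z p ⬝ᵥ
    ((kernelMatrix k z + v • (1 : Matrix (Fin n) (Fin n) ℝ))⁻¹ *ᵥ kernelVec k z p)

/-- Posterior standard deviation. -/
def postSd {D : Type*} (k : D → D → ℝ) (v : ℝ) {n : ℕ} (z : Fin n → D) (p : D) : ℝ :=
  Real.sqrt (postVar k v z p)

/-- Maximum information gain: half the supremum of `log det (I + v⁻¹ K)` over all `t`-tuples of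
points (repetitions are allowed). -/
def maxInfoGain {D : Type*} (k : D → D → ℝ) (v : ℝ) (t : ℕ) : ℝ :=
  (1 / 2) * ⨆ z : Fin t → D,
    Real.log (1 + v⁻¹ • kernelMatrix k z : Matrix (Fin t) (Fin t) ℝ).det

/-- The chi-squared distribution with `d ≥ 1` degrees of freedom, that is, the distribution with
density `x ^ (d/2 - 1) * exp (-x/2) / (2 ^ (d/2) * Γ (d/2))` on the positive half line. -/
def chiSquared (d : ℕ) : Measure ℝ := gammaMeasure ((d : ℝ) / 2) (1 / 2)

/-- `f` is (a random function distributed as) a sample path of the Gaussian process with mean zero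
and covariance function `k`. -/
structure IsGPSamplePath {D Ω' : Type*} [MeasurableSpace Ω'] (P : Measure Ω') (k : D → D → ℝ)
    (f : Ω' → D → ℝ) : Prop where
  measurable : Measurable f
  gaussian : IsGaussianProcess (fun (z : D) (ω : Ω') => f ω z) P
  mean_zero : ∀ z, ∫ ω, f ω z ∂P = 0
  covariance_eq : ∀ z z', cov[fun ω => f ω z, fun ω => f ω z'; P] = k z z'

/-- The probabilistic model: `f` is a sample path of the centred GP with covariance `k`, the noise
terms `ε n` have law `N(0, v)`, the `ξ n` have the chi-squared law with two degrees of freedom, and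
`f, ε 0, ε 1, …, ξ 0, ξ 1, …` are mutually independent. (Mutual independence is stated as
independence within the two sequences and of the three blocks.) -/
structure IsModel {D Ω' : Type*} [MeasurableSpace Ω'] (P : Measure Ω') (k : D → D → ℝ) (v : ℝ≥0)
    (f : Ω' → D → ℝ) (ε ξ : ℕ → Ω' → ℝ) : Prop where
  path : IsGPSamplePath P k f
  noise_measurable : ∀ n, Measurable (ε n)
  noise_law : ∀ n, HasLaw (ε n) (gaussianReal 0 v) P
  chi_measurable : ∀ n, Measurable (ξ n)
  chi_law : ∀ n, HasLaw (ξ n) (chiSquared 2) P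
  noise_indep : iIndepFun ε P
  chi_indep : iIndepFun ξ P
  noise_chi_indep : IndepFun (fun ω n => ε n ω) (fun ω n => ξ n ω) P
  path_indep : IndepFun f (fun ω => ((fun n => ε n ω), (fun n => ξ n ω))) P

/-! ### The algorithm

Rounds are numbered from `0`: in round `n` (round `n + 1` in one-based numbering) exactly the `n`
observations of the earlier rounds are available, so quantities with index `n` below are those
written `μ_{t-1}, σ_{t-1}, lcb_{t-1}, ucb_{t-1}, β_t, x_t, w_t` with `t = n + 1`. -/

/-- `β = 2 log |X × W| + ξ`. -/
def beta (X W : Type*) [Fintype X] [Fintype W] (s : ℝ) : ℝ :=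
  2 * Real.log (Fintype.card (X × W) : ℝ) + s

section Run

variable {X W Ω' : Type*}

/-- The points evaluated before round `n`. -/
def pts (x : ℕ → Ω' → X) (w : ℕ → Ω' → W) (n : ℕ) (ω : Ω') : Fin n → X × W :=
  fun i => (x i ω, w i ω)

/-- The observation of round `n`: `y_n = f (x_n, w_n) + ε_n`. -/
def obs (f : Ω' → X × W → ℝ) (ε : ℕ → Ω' → ℝ) (x : ℕ → Ω' → X) (w : ℕ → Ω' → W)
    (n : ℕ) (ω : Ω') : ℝ :=
  f ω (x n ω, w n ω) + ε n ω

/-- Posterior mean of `f (x', w')` at the start of round `n`. -/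
def mu (k : X × W → X × W → ℝ) (v : ℝ≥0) (f : Ω' → X × W → ℝ) (ε : ℕ → Ω' → ℝ)
    (x : ℕ → Ω' → X) (w : ℕ → Ω' → W) (n : ℕ) (ω : Ω') (x' : X) (w' : W) : ℝ :=
  postMean k (v : ℝ) (pts x w n ω) (fun i => obs f ε x w i ω) (x', w')

/-- Posterior standard deviation of `f (x', w')` at the start of round `n`. -/
def sd (k : X × W → X × W → ℝ) (v : ℝ≥0) (x : ℕ → Ω' → X) (w : ℕ → Ω' → W)
    (n : ℕ) (ω : Ω') (x' : X) (w' : W) : ℝ :=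
  postSd k (v : ℝ) (pts x w n ω) (x', w')

/-- The information contained in the data `(x_i, w_i, y_i, β_i)`, `i < n`. -/
@[reducible] def dataSigma [Fintype X] [Fintype W] [MeasurableSpace X] [MeasurableSpace W]
    (f : Ω' → X × W → ℝ) (ε ξ : ℕ → Ω' → ℝ)
    (x : ℕ → Ω' → X) (w : ℕ → Ω' → W) (n : ℕ) : MeasurableSpace Ω' :=
  MeasurableSpace.comap
    (fun ω (i : Fin n) => (x i ω, w i ω, obs f ε x w i ω, beta X W (ξ i ω))) inferInstance

/-- The lower and upper credible bounds `lcb n ω x'`, `ucb n ω x'` enclose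
`ρ (g)` for every function `g` of the environmental variable that lies in the credible interval
`[μ - β^{1/2} σ, μ + β^{1/2} σ]` at every `w'`. -/
def CredibleBounds [Fintype X] [Fintype W] [MeasurableSpace Ω'] (P : Measure Ω')
    (k : X × W → X × W → ℝ) (v : ℝ≥0) (ρ : (W → ℝ) → ℝ)
    (f : Ω' → X × W → ℝ) (ε ξ : ℕ → Ω' → ℝ) (lcb ucb : ℕ → Ω' → X → ℝ)
    (x : ℕ → Ω' → X) (w : ℕ → Ω' → W) : Prop :=
  ∀ n, ∀ᵐ ω ∂P, ∀ (x' : X) (g : W → ℝ),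
    (∀ w', g w' ∈ Set.Icc
      (mu k v f ε x w n ω x' w' - Real.sqrt (beta X W (ξ n ω)) * sd k v x w n ω x' w')
      (mu k v f ε x w n ω x' w' + Real.sqrt (beta X W (ξ n ω)) * sd k v x w n ω x' w')) →
    lcb n ω x' ≤ ρ g ∧ ρ g ≤ ucb n ω x'

/-- `xhat, xtil, x, w` are produced by RRGP-UCB (with arbitrary tie-breaking in each argmax).
The choices use only available information: `xhat n` is a function of the earlier data, and
`x n`, `w n` are functions of the earlier data and of the current `β`. -/
structure IsRRGPUCB [Fintype X] [Fintype W] [MeasurableSpace X] [MeasurableSpace W]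
    (k : X × W → X × W → ℝ) (v : ℝ≥0) (ρ : (W → ℝ) → ℝ)
    (f : Ω' → X × W → ℝ) (ε ξ : ℕ → Ω' → ℝ) (lcb ucb : ℕ → Ω' → X → ℝ)
    (xhat xtil x : ℕ → Ω' → X) (w : ℕ → Ω' → W) : Prop where
  xhat_measurable : ∀ n, Measurable[dataSigma f ε ξ x w n] (xhat n)
  x_measurable : ∀ n, Measurable[dataSigma f ε ξ x w n ⊔
    MeasurableSpace.comap (fun ω => beta X W (ξ n ω)) inferInstance] (x n)
  w_measurable : ∀ n, Measurable[dataSigma f ε ξ x w n ⊔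
    MeasurableSpace.comap (fun ω => beta X W (ξ n ω)) inferInstance] (w n)
  /-- `xhat` maximizes `ρ (μ (x', ·))`. -/
  xhat_argmax : ∀ n ω x', ρ (mu k v f ε x w n ω x') ≤ ρ (mu k v f ε x w n ω (xhat n ω))
  /-- `xtil` maximizes the positive part of `ucb x' - max lcb`. -/
  xtil_argmax : ∀ n ω x', max (ucb n ω x' - ⨆ a, lcb n ω a) 0 ≤
    max (ucb n ω (xtil n ω) - ⨆ a, lcb n ω a) 0
  /-- `x` maximizes `ucb - lcb` over the two points `xtil`, `xhat`. -/
  x_mem : ∀ n ω, x n ω = xtil n ω ∨ x n ω = xhat n ω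
  x_ge_xtil : ∀ n ω, ucb n ω (xtil n ω) - lcb n ω (xtil n ω) ≤
    ucb n ω (x n ω) - lcb n ω (x n ω)
  x_ge_xhat : ∀ n ω, ucb n ω (xhat n ω) - lcb n ω (xhat n ω) ≤
    ucb n ω (x n ω) - lcb n ω (x n ω)
  /-- `w` maximizes the posterior variance at `x`. -/
  w_argmax : ∀ n ω w', sd k v x w n ω (x n ω) w' ^ 2 ≤ sd k v x w n ω (x n ω) (w n ω) ^ 2

/-- Robustness measure `F (x') = ρ (f (x', ·))`. -/
def robust (ρ : (W → ℝ) → ℝ) (f : Ω' → X × W → ℝ) (ω : Ω') (x' : X) : ℝ :=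
  ρ (fun w' => f ω (x', w'))

/-- Cumulative regret of the first `t` rounds; the optimal value `F (x*)` is the maximum of `F`. -/
def cumRegret (ρ : (W → ℝ) → ℝ) (f : Ω' → X × W → ℝ) (xhat : ℕ → Ω' → X) (t : ℕ) (ω : Ω') : ℝ :=
  ∑ n ∈ Finset.range t, ((⨆ a, robust ρ f ω a) - robust ρ f ω (xhat n ω))

end Run

/-! ### The function class and the constants -/

/-- Non-decreasing concave functions on `[0, ∞)` with value `0` at `0` (hence non-negative there).
Values outside `[0, ∞)` are irrelevant. -/
structure IsClassH (h : ℝ → ℝ) : Prop where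
  monotone : MonotoneOn h (Set.Ici 0)
  concave : ConcaveOn ℝ (Set.Ici 0) h
  zero : h 0 = 0

/-- An expression `q (a) = ∑ i, ζ i * h i (∑ j, lam i j * a ^ ν i j)` of the class `𝒬`. -/
structure QFun where
  n : ℕ
  s : Fin n → ℕ
  ζ : Fin n → ℝ
  h : Fin n → ℝ → ℝ
  lam : (i : Fin n) → Fin (s i) → ℝ
  ν : (i : Fin n) → Fin (s i) → ℝ
  ζ_nonneg : ∀ i, 0 ≤ ζ i
  lam_nonneg : ∀ i j, 0 ≤ lam i j
  ν_pos : ∀ i j, 0 < ν i j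
  h_mem : ∀ i, IsClassH (h i)

/-- The function `q` given by the expression. -/
def QFun.eval (q : QFun) (a : ℝ) : ℝ :=
  ∑ i, q.ζ i * q.h i (∑ j, q.lam i j * a ^ q.ν i j)

/-- `ucb (x_n) - lcb (x_n) ≤ q (2 β_n^{1/2} max_w σ (x_n, w))` in every round, almost surely. -/
def WidthBound {X W Ω' : Type*} [Fintype X] [Fintype W] [MeasurableSpace Ω'] (P : Measure Ω')
    (k : X × W → X × W → ℝ) (v : ℝ≥0) (ξ : ℕ → Ω' → ℝ) (lcb ucb : ℕ → Ω' → X → ℝ)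
    (x : ℕ → Ω' → X) (w : ℕ → Ω' → W) (q : QFun) : Prop :=
  ∀ n, ∀ᵐ ω ∂P, ucb n ω (x n ω) - lcb n ω (x n ω) ≤
    q.eval (2 * Real.sqrt (beta X W (ξ n ω)) * ⨆ w', sd k v x w n ω (x n ω) w')

/-- `C₁ = 2 / log (1 + v⁻¹)`, with `v` the noise variance. -/
def constC1 (v : ℝ≥0) : ℝ := 2 / Real.log (1 + (v : ℝ)⁻¹)

/-- `ν' = min ν 1`. -/
def nuPrime (ν : ℝ) : ℝ := min ν 1

/-- `C_{2,ν} = E[β ^ (ν / (2 - ν'))]`, where `β - 2 log |X × W|` has the chi-squared law with two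
degrees of freedom. -/
def constC2 (X W : Type*) [Fintype X] [Fintype W] (ν : ℝ) : ℝ :=
  ∫ s, beta X W s ^ (ν / (2 - nuPrime ν)) ∂(chiSquared 2)

end

end RRGPUCB

/-! The law of `β` does not grow with the round, so a credible box that holds in all rounds at once
is not available; instead, each round is handled in expectation. Given the past, the deviations of
`f` from the posterior mean are centred Gaussian with the posterior variances. By a union bound over
`X × W` they leave the box of radius `√(2 log |X × W| + s)` posterior deviations with probability at
most `exp (-s / 2)`, which is exactly the probability that a chi-squared variable with two degrees
of freedom exceeds `s > 0`. If the regret is at most `G s` on the box with parameter `s`, it is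
therefore stochastically dominated by `G ξ`, so its mean is at most that of `G ξ`, and no failure
probability is paid (`lintegral_le_lintegral_chiSquared`). Here `G` is twice `q` of the width, by
the deterministic comparison `simpleRegret_le`.

The adaptive design is reduced to deterministic ones, of which there are finitely many in each
round. For a fixed design `ζ`, residuals and observations are jointly Gaussian and uncorrelated,
hence independent (`indepFun_residual_fixedObs`). Whether the algorithm produced `ζ` depends only on
these observations and the past chi-squared variables (`exists_pts_eq_iff`), so this event does not
disturb the law of the residuals. Summing over `ζ` gives `lintegral_simpleRegret_le`.

Over the rounds, Jensen's inequality moves the average and the expectation inside each concave `h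
i`. Hölder's inequality separates powers of `β` from posterior variances, and the sum of the
variances is at most `C₁ γ_t`, since the log determinant telescopes along Schur complements
(`sum_postVar_le`). -/

namespace RRGPUCB

/-! ### Posterior variances, Schur complements and information gain -/

section LinearAlgebra

variable {D : Type*} {k : D → D → ℝ} {v : ℝ}

theorem kernelMatrix_posSemidef (hk : (Matrix.of k).PosSemidef) {n : ℕ} (z : Fin n → D) :
    (kernelMatrix k z).PosSemidef :=
  hk.submatrix z

theorem kernelMatrix_add_posDef (hk : (Matrix.of k).PosSemidef) (hv : 0 < v) {n : ℕ}
    (z : Fin n → D) :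
    (kernelMatrix k z + v • (1 : Matrix (Fin n) (Fin n) ℝ)).PosDef :=
  Matrix.PosDef.posSemidef_add (kernelMatrix_posSemidef hk z) (Matrix.PosDef.one.smul hv)

theorem postVar_le (hk : (Matrix.of k).PosSemidef) (hv : 0 < v) {n : ℕ} (z : Fin n → D) (p : D) :
    postVar k v z p ≤ k p p := by
  have h := ((kernelMatrix_add_posDef hk hv z).inv.posSemidef).dotProduct_mulVec_nonneg
    (kernelVec k z p)
  simp only [star_trivial] at h
  unfold postVar
  linarith

theorem kernel_symm (hk : (Matrix.of k).PosSemidef) (a b : D) : k a b = k b a := by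
  simpa using (hk.isHermitian.apply b a)

/-- The last diagonal entry `c` stays free: `c = 0` serves for the sign of the posterior variance,
`c = v` for the determinant recursion. -/
theorem kernelMatrix_succ_add (hk : (Matrix.of k).PosSemidef) (v : ℝ) {n : ℕ} (z : Fin n → D)
    (p : D) (c : ℝ) :
    (kernelMatrix k (Fin.snoc z p : Fin (n + 1) → D) +
      Matrix.diagonal (Fin.snoc (fun _ => v) c : Fin (n + 1) → ℝ)).submatrix
        (finSumFinEquiv : Fin n ⊕ Fin 1 ≃ Fin (n + 1)) finSumFinEquiv =
    Matrix.fromBlocks (kernelMatrix k z + v • (1 : Matrix (Fin n) (Fin n) ℝ))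
      (Matrix.replicateCol (Fin 1) (kernelVec k z p))
      (Matrix.replicateRow (Fin 1) (kernelVec k z p)) (Matrix.of fun _ _ => k p p + c) := by
  have hc : ∀ i : Fin n, Fin.castAdd 1 i = Fin.castSucc i := fun _ => rfl
  have hn : ∀ i : Fin 1, Fin.natAdd n i = Fin.last n := fun i => by
    ext; simp
  ext i j
  rcases i with i | i <;> rcases j with j | j
  · simp [hc, kernelMatrix, Matrix.diagonal_apply, Matrix.one_apply]
  · simp [hc, hn, kernelMatrix, kernelVec, kernel_symm hk p,
      (Fin.castSucc_lt_last _).ne]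
  · simp [hc, hn, kernelMatrix, kernelVec, (Fin.castSucc_lt_last _).ne']
  · simp [hn, kernelMatrix]

theorem schurComplement_replicate_eq (n : ℕ) (M : Matrix (Fin n) (Fin n) ℝ) (u : Fin n → ℝ) (a : ℝ) :
    (Matrix.of fun _ _ => a) - Matrix.replicateRow (Fin 1) u * M⁻¹ * Matrix.replicateCol (Fin 1) u =
      Matrix.of fun _ _ => a - u ⬝ᵥ (M⁻¹ *ᵥ u) := by
  ext i j
  rw [Matrix.mul_assoc]
  simp [Matrix.mul_apply, dotProduct, Matrix.mulVec]

/-- The posterior variance is the Schur complement in the bordered matrix with no noise on the new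
point, and that matrix is still positive semidefinite. -/
theorem postVar_nonneg (hk : (Matrix.of k).PosSemidef) (hv : 0 < v) {n : ℕ} (z : Fin n → D)
    (p : D) : 0 ≤ postVar k v z p := by
  have hM := kernelMatrix_add_posDef hk hv z
  have hbig : (kernelMatrix k (Fin.snoc z p : Fin (n + 1) → D) +
      Matrix.diagonal (Fin.snoc (fun _ => v) 0 : Fin (n + 1) → ℝ)).PosSemidef := by
    refine (kernelMatrix_posSemidef hk _).add (Matrix.PosSemidef.diagonal ?_)
    intro i
    refine Fin.lastCases ?_ (fun i => ?_) i <;> simp [hv.le]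
  have h := hbig.submatrix (finSumFinEquiv : Fin n ⊕ Fin 1 ≃ Fin (n + 1))
  rw [kernelMatrix_succ_add hk] at h
  have hrow : Matrix.replicateRow (Fin 1) (kernelVec k z p) =
      (Matrix.replicateCol (Fin 1) (kernelVec k z p))ᴴ := by
    ext; simp
  have := hM.isUnit.invertible
  rw [hrow, Matrix.PosDef.fromBlocks₁₁ _ _ hM,
    ← hrow, schurComplement_replicate_eq] at h
  have h' := h.diag_nonneg (i := 0)
  simpa [postVar] using h'

theorem det_kernelMatrix_succ (hk : (Matrix.of k).PosSemidef) (hv : 0 < v) {n : ℕ} (z : Fin n → D)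
    (p : D) :
    (kernelMatrix k (Fin.snoc z p : Fin (n + 1) → D) +
      v • (1 : Matrix (Fin (n + 1)) (Fin (n + 1)) ℝ)).det =
    (kernelMatrix k z + v • (1 : Matrix (Fin n) (Fin n) ℝ)).det * (postVar k v z p + v) := by
  have hM := kernelMatrix_add_posDef hk hv z
  have h := kernelMatrix_succ_add hk v z p v
  have hd : Matrix.diagonal (Fin.snoc (fun _ => v) v : Fin (n + 1) → ℝ) =
      v • (1 : Matrix (Fin (n + 1)) (Fin (n + 1)) ℝ) := by
    rw [Matrix.smul_one_eq_diagonal]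
    congr 1
    ext i
    refine Fin.lastCases ?_ (fun i => ?_) i <;> simp
  rw [hd] at h
  have := hM.isUnit.invertible
  rw [← Matrix.det_submatrix_equiv_self (finSumFinEquiv : Fin n ⊕ Fin 1 ≃ Fin (n + 1)), h,
    Matrix.det_fromBlocks₁₁, Matrix.invOf_eq_nonsing_inv, schurComplement_replicate_eq]
  congr 1
  simp [postVar]
  ring

theorem det_one_add_kernelMatrix (hv : 0 < v) {n : ℕ} (z : Fin n → D) :
    (1 + v⁻¹ • kernelMatrix k z : Matrix (Fin n) (Fin n) ℝ).det =
      v⁻¹ ^ n * (kernelMatrix k z + v • (1 : Matrix (Fin n) (Fin n) ℝ)).det := by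
  have : (1 + v⁻¹ • kernelMatrix k z : Matrix (Fin n) (Fin n) ℝ) =
      v⁻¹ • (kernelMatrix k z + v • (1 : Matrix (Fin n) (Fin n) ℝ)) := by
    rw [smul_add, smul_smul, inv_mul_cancel₀ hv.ne', one_smul, add_comm]
  rw [this, Matrix.det_smul, Fintype.card_fin]

/-- Each new point multiplies the determinant by `1 + v⁻¹ σ²`, so the logarithms telescope. -/
theorem sum_log_postVar (hk : (Matrix.of k).PosSemidef) (hv : 0 < v) (z : ℕ → D) (t : ℕ) :
    ∑ n ∈ Finset.range t, Real.log (1 + v⁻¹ * postVar k v (fun i : Fin n => z i) (z n)) =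
      Real.log (1 + v⁻¹ • kernelMatrix k (fun i : Fin t => z i) :
        Matrix (Fin t) (Fin t) ℝ).det := by
  induction t with
  | zero => simp
  | succ t ih =>
    have hz : (fun i : Fin (t + 1) => z i) = Fin.snoc (fun i : Fin t => z i) (z t) := by
      ext i
      refine Fin.lastCases ?_ (fun i => ?_) i <;> simp
    have hpos := (kernelMatrix_add_posDef hk hv (fun i : Fin t => z i)).det_pos
    have hnn := postVar_nonneg hk hv (fun i : Fin t => z i) (z t)
    rw [Finset.sum_range_succ, ih, hz, det_one_add_kernelMatrix hv, det_one_add_kernelMatrix hv,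
      det_kernelMatrix_succ hk hv, ← Real.log_mul (by positivity) (by positivity)]
    congr 1
    rw [pow_succ, show postVar k v (fun i : Fin t => z i) (z t) + v =
      v * (1 + v⁻¹ * postVar k v (fun i : Fin t => z i) (z t)) by field_simp; ring]
    field_simp

/-- Bernoulli's inequality `(1 + a) ^ s ≤ 1 + a s`. With `a = v⁻¹` it bounds a variance in `[0, 1]`
by its logarithmic term, which is the source of `C₁`. -/
theorem mul_log_le_log {s a : ℝ} (hs0 : 0 ≤ s) (hs1 : s ≤ 1) (ha : 0 ≤ a) :
    s * Real.log (1 + a) ≤ Real.log (1 + a * s) := by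
  rw [← Real.log_rpow (by linarith)]
  refine Real.log_le_log (by positivity) ?_
  have := rpow_one_add_le_one_add_mul_self (s := a) (by linarith) hs0 hs1
  linarith [mul_comm a s]

theorem sum_postVar_le [Finite D] (hk : (Matrix.of k).PosSemidef) (hk_le : ∀ z, k z z ≤ 1) {v : ℝ≥0}
    (hv : 0 < v) (z : ℕ → D) (t : ℕ) :
    ∑ n ∈ Finset.range t, postVar k (v : ℝ) (fun i : Fin n => z i) (z n) ≤
      constC1 v * maxInfoGain k (v : ℝ) t := by
  have hv' : (0 : ℝ) < v := hv
  have hL : 0 < Real.log (1 + (v : ℝ)⁻¹) := Real.log_pos (by have := inv_pos.2 hv'; linarith)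
  have h1 : (∑ n ∈ Finset.range t, postVar k (v : ℝ) (fun i : Fin n => z i) (z n)) *
      Real.log (1 + (v : ℝ)⁻¹) ≤ 2 * maxInfoGain k (v : ℝ) t := by
    rw [Finset.sum_mul]
    calc _ ≤ ∑ n ∈ Finset.range t,
          Real.log (1 + (v : ℝ)⁻¹ * postVar k (v : ℝ) (fun i : Fin n => z i) (z n)) :=
          Finset.sum_le_sum fun n _ => mul_log_le_log (postVar_nonneg hk hv' _ _)
            ((postVar_le hk hv' _ _).trans (hk_le _)) (inv_pos.2 hv').le
      _ = _ := sum_log_postVar hk hv' z t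
      _ ≤ ⨆ z : Fin t → D,
            Real.log (1 + (v : ℝ)⁻¹ • kernelMatrix k z : Matrix (Fin t) (Fin t) ℝ).det :=
          le_ciSup (f := fun z : Fin t → D =>
            Real.log (1 + (v : ℝ)⁻¹ • kernelMatrix k z : Matrix (Fin t) (Fin t) ℝ).det)
            (Set.finite_range _).bddAbove (fun i : Fin t => z i)
      _ = _ := by rw [maxInfoGain]; ring
  rw [constC1, div_mul_eq_mul_div, le_div_iff₀ hL]
  exact h1

end LinearAlgebra

/-! ### Stochastic domination by a chi-squared variable -/

section CredibleLayerCake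

open scoped ENNReal

/-- Sharp two-sided Gaussian tail bound. -/
theorem gaussianReal_tail_le (V : ℝ≥0) (b : ℝ) :
    gaussianReal 0 V {r | √b * √V < |r|} ≤ ENNReal.ofReal (Real.exp (-b / 2)) := by
  rcases lt_or_ge b 0 with hb | hb
  · refine prob_le_one.trans ?_
    rw [ENNReal.one_le_ofReal, Real.one_le_exp_iff]
    linarith
  rcases eq_or_ne V 0 with rfl | hV
  · simp
  have hV' : (0 : ℝ) < V := lt_of_le_of_ne V.2 (by exact_mod_cast hV.symm)
  set u : ℝ := √b * √V with hu
  have hu0 : 0 ≤ u := by positivity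
  have hu2 : u ^ 2 = b * V := by rw [hu, mul_pow, Real.sq_sqrt hb, Real.sq_sqrt hV'.le]
  set e : ℝ≥0∞ := ENNReal.ofReal (Real.exp (-b / 2))
  -- As `x c ≥ 0`, `(x + c)² ≥ x² + c²`: moving outwards by `c` costs the density a factor `exp (-c²
  -- / (2 V)) = exp (-b / 2)`.
  have key : ∀ x c : ℝ, c ^ 2 = b * V → 0 ≤ x * c →
      gaussianPDF 0 V (x + c) ≤ e * gaussianPDF 0 V x := by
    intro x c hc hxc
    rw [gaussianPDF, gaussianPDF, ← ENNReal.ofReal_mul (Real.exp_pos _).le]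
    refine ENNReal.ofReal_le_ofReal ?_
    rw [gaussianPDFReal, gaussianPDFReal, mul_left_comm, ← Real.exp_add]
    gcongr
    have : -b / 2 + -(x - 0) ^ 2 / (2 * V) - -(x + c - 0) ^ 2 / (2 * V) = x * c / V := by
      field_simp
      linear_combination hc
    have h2 : 0 ≤ x * c / V := by positivity
    linarith
  have hset : {r : ℝ | u < |r|} = Set.Ioi u ∪ Set.Iio (-u) := by
    ext r
    simp only [Set.mem_ofPred_eq, Set.mem_union, Set.mem_Ioi, Set.mem_Iio, lt_abs]
    constructor <;> rintro (h | h) <;> [left; right; left; right] <;> linarith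
  have shift : ∀ (A B : Set ℝ) (c : ℝ), MeasurableSet A → MeasurableSet B → c ^ 2 = b * V →
      (∀ x, x + c ∈ A ↔ x ∈ B) → (∀ x ∈ B, 0 ≤ x * c) →
      gaussianReal 0 V A ≤ e * gaussianReal 0 V B := by
    intro A B c hA hB hc hAB hBc
    rw [gaussianReal_apply _ hV, gaussianReal_apply _ hV, ← lintegral_indicator hA,
      ← lintegral_add_right_eq_self _ c, ← lintegral_const_mul _ (measurable_gaussianPDF 0 V),
      ← lintegral_indicator hB]
    refine lintegral_mono fun x => ?_
    by_cases hx : x ∈ B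
    · rw [Set.indicator_of_mem hx, Set.indicator_of_mem ((hAB x).2 hx)]
      exact key x c hc (hBc x hx)
    · rw [Set.indicator_of_notMem (fun h => hx ((hAB x).1 h))]
      exact zero_le
  rw [hset]
  calc gaussianReal 0 V (Set.Ioi u ∪ Set.Iio (-u))
      ≤ gaussianReal 0 V (Set.Ioi u) + gaussianReal 0 V (Set.Iio (-u)) := measure_union_le _ _
    -- Each tail is a translate of a half line. The two half lines together have mass at most one,
    -- so no factor 2 appears.
    _ ≤ e * gaussianReal 0 V (Set.Ioi 0) + e * gaussianReal 0 V (Set.Iio 0) := by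
        refine add_le_add (shift _ _ u measurableSet_Ioi measurableSet_Ioi hu2 (fun x => ?_)
          fun x hx => ?_) (shift _ _ (-u) measurableSet_Iio measurableSet_Iio (by simpa using hu2)
          (fun x => ?_) fun x hx => ?_)
        · simp
        · exact mul_nonneg (le_of_lt hx) hu0
        · simp
        · exact mul_nonneg_of_nonpos_of_nonpos (le_of_lt hx) (by linarith)
    _ = e * gaussianReal 0 V (Set.Ioi 0 ∪ Set.Iio 0) := by
        rw [measure_union _ measurableSet_Iio, mul_add]
        exact Set.disjoint_left.2 fun x (h1 : 0 < x) (h2 : x < 0) => lt_asymm h1 h2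
    _ ≤ e := mul_le_of_le_one_right' prob_le_one

theorem chiSquared_two : chiSquared 2 = expMeasure (1 / 2) := by
  simp [chiSquared, expMeasure]

instance : IsProbabilityMeasure (chiSquared 2) := by
  rw [chiSquared_two]
  exact isProbabilityMeasure_expMeasure (by norm_num)

/-- With two degrees of freedom the survival function is `exp (-s / 2)`, the same expression as the
failure bound of the credible box. -/
theorem chiSquared_two_Iic {p : ℝ} (hp0 : 0 < p) (hp1 : p ≤ 1) :
    chiSquared 2 (Set.Iic (-2 * Real.log p)) = ENNReal.ofReal (1 - p) := by
  have := isProbabilityMeasure_expMeasure (r := 1 / 2) (by norm_num)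
  rw [chiSquared_two, ← ofReal_cdf, cdf_expMeasure_eq (by norm_num), if_pos
    (by have := Real.log_nonpos hp0.le hp1; linarith),
    show -(1 / 2 * (-2 * Real.log p)) = Real.log p by ring, Real.exp_log hp0]

/-- A function bounded by `G s` on sets `B s` of mass at least `1 - exp (-s / 2)` has a smaller
mean than `G s` for `s` chi-squared with two degrees of freedom. -/
theorem lintegral_le_lintegral_chiSquared {E : Type*} [MeasurableSpace E] (κ : Measure E)
    [IsProbabilityMeasure κ] (B : ℝ → Set E)
    (hB : ∀ s, κ (B s)ᶜ ≤ ENNReal.ofReal (Real.exp (-s / 2)))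
    {Δ : E → ℝ} (hΔ : Measurable Δ) (hΔ0 : ∀ r, 0 ≤ Δ r)
    {G : ℝ → ℝ} (hG : Measurable G) (hG0 : ∀ s, 0 ≤ G s)
    (h : ∀ᵐ s ∂chiSquared 2, ∀ᵐ r ∂κ, r ∈ B s → Δ r ≤ G s) :
    ∫⁻ r, ENNReal.ofReal (Δ r) ∂κ ≤ ∫⁻ s, ENNReal.ofReal (G s) ∂chiSquared 2 := by
  rw [lintegral_eq_lintegral_meas_lt _ (ae_of_all _ hΔ0) hΔ.aemeasurable,
    lintegral_eq_lintegral_meas_lt _ (ae_of_all _ hG0) hG.aemeasurable]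
  refine lintegral_mono fun c => ?_
  set p := κ {a | c < Δ a}
  rcases eq_or_ne p 0 with hp | hp
  · simp [hp]
  have hp1 : p ≤ 1 := prob_le_one
  have hptop : p ≠ ∞ := ne_top_of_le_ne_top ENNReal.one_ne_top hp1
  have hp0' : 0 < p.toReal := ENNReal.toReal_pos hp hptop
  have hp1' : p.toReal ≤ 1 := by simpa using ENNReal.toReal_mono ENNReal.one_ne_top hp1
  have hms : MeasurableSet {s | c < G s} := measurableSet_lt measurable_const hG
  -- Layer-cake comparison at level `c`: if `G s ≤ c`, then `Δ ≤ c` on `B s`, so `p ≤ exp (-s / 2)`,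
  -- that is `s ≤ -2 log p`. Such `s` have mass at most `1 - p`, so `G` exceeds `c` with probability
  -- at least `p`.
  have hle : chiSquared 2 {s | c < G s}ᶜ ≤ chiSquared 2 (Set.Iic (-2 * Real.log p.toReal)) := by
    refine measure_mono_ae ?_
    filter_upwards [h] with s hs hsc
    have hsc' : G s ≤ c := not_lt.1 hsc
    have h1 : p ≤ κ (B s)ᶜ := by
      refine measure_mono_ae ?_
      filter_upwards [hs] with r hr hrc hrB
      exact absurd ((hr hrB).trans hsc') (not_le.2 hrc)
    have h2 : p.toReal ≤ Real.exp (-s / 2) := by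
      have := ENNReal.toReal_mono ENNReal.ofReal_ne_top (h1.trans (hB s))
      rwa [ENNReal.toReal_ofReal (Real.exp_pos _).le] at this
    have h3 := (Real.log_le_iff_le_exp hp0').2 h2
    change s ≤ -2 * Real.log p.toReal
    linarith
  rw [chiSquared_two_Iic hp0' hp1', prob_compl_eq_one_sub hms,
    ENNReal.ofReal_sub _ hp0'.le, ENNReal.ofReal_one, ENNReal.ofReal_toReal hptop] at hle
  exact (ENNReal.sub_le_sub_iff_left hp1 ENNReal.one_ne_top).1 hle

theorem setLIntegral_indepFun {Ω' α F : Type*} [MeasurableSpace Ω'] [MeasurableSpace α]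
    [MeasurableSpace F] {P : Measure Ω'} [IsProbabilityMeasure P] {Y : Ω' → α} {T : Ω' → F}
    (hY : Measurable Y) (hT : Measurable T) (hYT : IndepFun Y T P) {H : α × F → ℝ}
    (hH : Measurable H) {U : Set α} (hU : MeasurableSet U) :
    ∫⁻ ω in Y ⁻¹' U, ENNReal.ofReal (H (Y ω, T ω)) ∂P =
      ∫⁻ a in U, ∫⁻ r, ENNReal.ofReal (H (a, r)) ∂P.map T ∂P.map Y := by
  have : IsProbabilityMeasure (P.map T) := Measure.isProbabilityMeasure_map hT.aemeasurable
  have hm : Measurable fun x : α × F => (U.indicator 1 x.1 : ℝ≥0∞) * ENNReal.ofReal (H x) :=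
    ((measurable_one.indicator hU).comp measurable_fst).mul hH.ennreal_ofReal
  rw [← lintegral_indicator (hY hU), ← lintegral_indicator hU]
  calc _ = ∫⁻ ω, (U.indicator 1 (Y ω) : ℝ≥0∞) * ENNReal.ofReal (H (Y ω, T ω)) ∂P := by
        refine lintegral_congr fun ω => ?_
        by_cases hω : Y ω ∈ U <;> simp [Set.indicator, hω]
    _ = ∫⁻ x, (U.indicator 1 x.1 : ℝ≥0∞) * ENNReal.ofReal (H x)
          ∂P.map (fun ω => (Y ω, T ω)) := by
        rw [lintegral_map hm (hY.prodMk hT)]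
    _ = _ := by
        rw [(indepFun_iff_map_prod_eq_prod_map_map hY.aemeasurable hT.aemeasurable).1 hYT,
          lintegral_prod _ hm.aemeasurable]
        refine lintegral_congr fun a => ?_
        by_cases ha : a ∈ U <;> simp [Set.indicator, ha]

/-- Freezing the past `Y = a` leaves the laws of `S` and `R` unchanged, so the domination lemma
applies for almost every `a`. The bound is required for every `r` in the box, not only for `R ω`;
this allows `S` and `R` to be integrated separately. -/
theorem setLIntegral_le_of_credible {Ω' α E : Type*} [MeasurableSpace Ω'] [MeasurableSpace α]
    [MeasurableSpace E] {P : Measure Ω'} [IsProbabilityMeasure P] {Y : Ω' → α} {R : Ω' → E}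
    {S : Ω' → ℝ} (hY : Measurable Y) (hR : Measurable R) (hS : Measurable S)
    (hSlaw : P.map S = chiSquared 2) (hYS : IndepFun Y S P)
    (hYSR : IndepFun (fun ω => (Y ω, S ω)) R P)
    {B : ℝ → Set E} (hBm : MeasurableSet {p : ℝ × E | p.2 ∈ B p.1})
    (hB : ∀ s, P.map R (B s)ᶜ ≤ ENNReal.ofReal (Real.exp (-s / 2)))
    {Δ : α × E → ℝ} (hΔ : Measurable Δ) (hΔ0 : ∀ r, 0 ≤ Δ r)
    {G : α × ℝ → ℝ} (hG : Measurable G) (hG0 : ∀ s, 0 ≤ G s)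
    {U : Set α} (hU : MeasurableSet U)
    (h : ∀ᵐ ω ∂P, Y ω ∈ U → ∀ r ∈ B (S ω), Δ (Y ω, r) ≤ G (Y ω, S ω)) :
    ∫⁻ ω in Y ⁻¹' U, ENNReal.ofReal (Δ (Y ω, R ω)) ∂P ≤
      ∫⁻ ω in Y ⁻¹' U, ENNReal.ofReal (G (Y ω, S ω)) ∂P := by
  have : IsProbabilityMeasure (P.map Y) := Measure.isProbabilityMeasure_map hY.aemeasurable
  have : IsProbabilityMeasure (P.map R) := Measure.isProbabilityMeasure_map hR.aemeasurable
  have hYR : IndepFun Y R P := hYSR.comp measurable_fst measurable_id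
  rw [setLIntegral_indepFun hY hR hYR hΔ hU, setLIntegral_indepFun hY hS hYS hG hU, hSlaw]
  let bad : Set ((α × ℝ) × E) :=
    {x | x.1.1 ∈ U ∧ x.2 ∈ B x.1.2 ∧ G x.1 < Δ (x.1.1, x.2)}
  have hbad : MeasurableSet bad := by
    refine (hU.preimage (measurable_fst.comp measurable_fst)).inter (MeasurableSet.inter ?_ ?_)
    · exact hBm.preimage ((measurable_snd.comp measurable_fst).prodMk measurable_snd)
    · exact measurableSet_lt (hG.comp measurable_fst)
        (hΔ.comp ((measurable_fst.comp measurable_fst).prodMk measurable_snd))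
  -- The almost sure hypothesis is carried to the product law of `(Y, S)`. The measure of the
  -- sections of `bad` is used because it depends measurably on the point.
  have hae : ∀ᵐ x ∂(P.map Y).prod (chiSquared 2), P.map R (Prod.mk x ⁻¹' bad) = 0 := by
    rw [← hSlaw, ← (indepFun_iff_map_prod_eq_prod_map_map hY.aemeasurable hS.aemeasurable).1 hYS,
      ae_map_iff (hY.prodMk hS).aemeasurable
        (measurableSet_eq_fun (measurable_measure_prodMk_left hbad) measurable_const)]
    filter_upwards [h] with ω hω
    convert measure_empty (μ := P.map R)
    ext r
    simp only [bad, Set.mem_preimage, Set.mem_ofPred_eq, Set.mem_empty_iff_false, iff_false,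
      not_and, not_lt]
    exact fun h1 h2 => hω h1 r h2
  refine setLIntegral_mono_ae' hU ?_
  filter_upwards [Measure.ae_ae_of_ae_prod hae] with a ha haU
  refine lintegral_le_lintegral_chiSquared _ B hB (hΔ.comp measurable_prodMk_left)
    (fun _ => hΔ0 _) (hG.comp measurable_prodMk_left) (fun _ => hG0 _) ?_
  filter_upwards [ha] with s hs
  rw [measure_eq_zero_iff_ae_notMem] at hs
  filter_upwards [hs] with r hr hrB
  by_contra hlt
  exact hr ⟨haU, hrB, not_le.1 hlt⟩

end CredibleLayerCake

/-! ### Regrouping independent variables -/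

section Independence

variable {Ω' α β γ : Type*} [MeasurableSpace Ω'] [MeasurableSpace α] [MeasurableSpace β]
  [MeasurableSpace γ] {P : Measure Ω'} [IsProbabilityMeasure P]
  {A : Ω' → α} {B : Ω' → β} {C : Ω' → γ}

theorem indepFun_prodMk_left (hA : Measurable A) (hB : Measurable B) (hC : Measurable C)
    (h : IndepFun A (fun ω => (B ω, C ω)) P) (hBC : IndepFun B C P) :
    IndepFun (fun ω => (A ω, B ω)) C P := by
  have := Measure.isProbabilityMeasure_map (μ := P) hA.aemeasurable
  have := Measure.isProbabilityMeasure_map (μ := P) hB.aemeasurable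
  have := Measure.isProbabilityMeasure_map (μ := P) hC.aemeasurable
  have hAB : IndepFun A B P := h.comp measurable_id measurable_fst
  rw [indepFun_iff_map_prod_eq_prod_map_map (by fun_prop) (by fun_prop)] at *
  apply MeasurableEquiv.prodAssoc.map_measurableEquiv_injective
  rw [hAB, Measure.prodAssoc_prod, ← hBC, ← h,
    Measure.map_map MeasurableEquiv.prodAssoc.measurable (by fun_prop)]
  rfl

theorem indepFun_prodMk_right (hA : Measurable A) (hB : Measurable B) (hC : Measurable C)
    (h : IndepFun (fun ω => (A ω, B ω)) C P) (hAB : IndepFun A B P) :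
    IndepFun A (fun ω => (B ω, C ω)) P := by
  have h1 : IndepFun C (fun ω => (B ω, A ω)) P := h.symm.comp measurable_id measurable_swap
  have h2 := indepFun_prodMk_left hC hB hA h1 hAB.symm
  exact h2.symm.comp measurable_id measurable_swap

end Independence

/-! ### Gaussian regression on a deterministic design -/

section FixedDesign

variable {D Ω' : Type*} [Fintype D] [MeasurableSpace Ω'] {P : Measure Ω'}
  [IsProbabilityMeasure P] {k : D → D → ℝ} {v : ℝ≥0} {f : Ω' → D → ℝ} {ε ξ : ℕ → Ω' → ℝ}

/-- Noisy observations at the points of a deterministic design. -/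
def fixedObs (f : Ω' → D → ℝ) (ε : ℕ → Ω' → ℝ) {n : ℕ} (ζ : Fin n → D) (ω : Ω') : Fin n → ℝ :=
  fun i => f ω (ζ i) + ε i ω

/-- Deviation of the sample path from the posterior mean for a deterministic design. -/
noncomputable def residual (k : D → D → ℝ) (v : ℝ) (f : Ω' → D → ℝ) (ε : ℕ → Ω' → ℝ) {n : ℕ}
    (ζ : Fin n → D) (ω : Ω') : D → ℝ :=
  fun p => f ω p - postMean k v ζ (fixedObs f ε ζ ω) p

/-- The weights of the observations in the posterior mean. -/
noncomputable def gain (k : D → D → ℝ) (v : ℝ) {n : ℕ} (ζ : Fin n → D) (p : D) : Fin n → ℝ :=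
  kernelVec k ζ p ᵥ* (kernelMatrix k ζ + v • (1 : Matrix (Fin n) (Fin n) ℝ))⁻¹

omit [Fintype D] in
theorem postMean_eq_sum (k : D → D → ℝ) (v : ℝ) {n : ℕ} (ζ : Fin n → D) (y : Fin n → ℝ) (p : D) :
    postMean k v ζ y p = ∑ l, gain k v ζ p l * y l := by
  rw [postMean, Matrix.dotProduct_mulVec]
  rfl

omit [Fintype D] in
theorem postVar_eq_sum (k : D → D → ℝ) (v : ℝ) {n : ℕ} (ζ : Fin n → D) (p : D) :
    postVar k v ζ p = k p p - ∑ l, gain k v ζ p l * k p (ζ l) := by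
  rw [postVar, Matrix.dotProduct_mulVec]
  rfl

/-- The linear map from the sample path and the noise to the residual and the observations. -/
noncomputable def designMap (k : D → D → ℝ) (v : ℝ) {n : ℕ} (ζ : Fin n → D) :
    ((D → ℝ) × (Fin n → ℝ)) →ₗ[ℝ] ((D → ℝ) × (Fin n → ℝ)) where
  toFun x := (fun p => x.1 p - ∑ l, gain k v ζ p l * (x.1 (ζ l) + x.2 l),
    fun i => x.1 (ζ i) + x.2 i)
  map_add' x y := by
    ext i
    · simp only [Prod.fst_add, Prod.snd_add, Pi.add_apply, mul_add, Finset.sum_add_distrib]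
      ring
    · simp only [Prod.fst_add, Prod.snd_add, Pi.add_apply]
      ring
  map_smul' c x := by
    ext i
    · simp only [Prod.smul_fst, Prod.smul_snd, Pi.smul_apply, smul_eq_mul, RingHom.id_apply,
        mul_sub, Finset.mul_sum]
      congr 1
      exact Finset.sum_congr rfl fun _ _ => by ring
    · simp only [Prod.smul_fst, Prod.smul_snd, Pi.smul_apply, smul_eq_mul, RingHom.id_apply]
      ring

omit [Fintype D] [MeasurableSpace Ω'] in
theorem designMap_apply (k : D → D → ℝ) (v : ℝ) (f : Ω' → D → ℝ) (ε : ℕ → Ω' → ℝ) {n : ℕ}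
    (ζ : Fin n → D) (ω : Ω') :
    (residual k v f ε ζ ω, fixedObs f ε ζ ω) = designMap k v ζ (f ω, fun i : Fin n => ε i ω) := by
  ext i
  · change f ω i - postMean k v ζ _ i = f ω i - _
    rw [postMean_eq_sum]
    rfl
  · rfl

omit [Fintype D] in
-- These are the normal equations of linear prediction; they make the residual uncorrelated with the
-- observations.
theorem sum_gain_mul (hk : (Matrix.of k).PosSemidef) {v : ℝ} (hv : 0 < v) {n : ℕ}
    (ζ : Fin n → D) (p : D) (j : Fin n) :
    ∑ l, gain k v ζ p l * (k (ζ l) (ζ j) + if l = j then v else 0) = k p (ζ j) := by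
  have hM := kernelMatrix_add_posDef hk hv ζ
  have h : gain k v ζ p ᵥ* (kernelMatrix k ζ + v • (1 : Matrix (Fin n) (Fin n) ℝ)) =
      kernelVec k ζ p := by
    rw [gain, Matrix.vecMul_vecMul, Matrix.nonsing_inv_mul _
      ((Matrix.isUnit_iff_isUnit_det _).1 hM.isUnit), Matrix.vecMul_one]
  have := congrFun h j
  simpa [Matrix.vecMul, dotProduct, kernelMatrix, kernelVec, Matrix.one_apply] using this

omit [Fintype D] [IsProbabilityMeasure P] in
theorem measurable_fixedObs (hm : IsModel P k v f ε ξ) {n : ℕ} (ζ : Fin n → D) :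
    Measurable (fixedObs f ε ζ) :=
  measurable_pi_lambda _ fun _ =>
    ((measurable_pi_apply _).comp hm.path.measurable).add (hm.noise_measurable _)

omit [Fintype D] [IsProbabilityMeasure P] in
theorem measurable_residual (hm : IsModel P k v f ε ξ) {n : ℕ} (ζ : Fin n → D) :
    Measurable (residual k v f ε ζ) := by
  refine measurable_pi_lambda _ fun p => ?_
  simp only [residual, postMean_eq_sum]
  have h1 : Measurable fun ω => f ω p := (measurable_pi_apply _).comp hm.path.measurable
  have h2 : ∀ l, Measurable fun ω => fixedObs f ε ζ ω l := fun l =>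
    (measurable_pi_apply _).comp (measurable_fixedObs hm ζ)
  fun_prop

omit [IsProbabilityMeasure P] in
theorem hasGaussianLaw_path_noise (hm : IsModel P k v f ε ξ) (n : ℕ) :
    HasGaussianLaw (fun ω => (f ω, fun i : Fin n => ε i ω)) P := by
  have hf : HasGaussianLaw f P := by
    have h := (hm.path.gaussian.hasGaussianLaw (Finset.univ : Finset D)).map
      (LinearMap.toContinuousLinearMap
        ({ toFun := fun x d => x ⟨d, Finset.mem_univ d⟩
           map_add' := fun _ _ => rfl
           map_smul' := fun _ _ => rfl } :
          (({d // d ∈ (Finset.univ : Finset D)} → ℝ) →ₗ[ℝ] (D → ℝ))))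
    exact h
  have hε : HasGaussianLaw (fun ω (i : Fin n) => ε i ω) P :=
    iIndepFun.hasGaussianLaw (X := fun (i : Fin n) ω => ε i ω)
      (fun i => (hm.noise_law i).hasGaussianLaw) (hm.noise_indep.precomp Fin.val_injective)
  refine IndepFun.hasGaussianLaw hf hε ?_
  have hg : Measurable fun p : (ℕ → ℝ) × (ℕ → ℝ) => fun i : Fin n => p.1 i := by fun_prop
  exact hm.path_indep.comp measurable_id hg

omit [IsProbabilityMeasure P] in
theorem hasGaussianLaw_residual_fixedObs (hm : IsModel P k v f ε ξ) {n : ℕ} (ζ : Fin n → D) :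
    HasGaussianLaw (fun ω => (residual k v f ε ζ ω, fixedObs f ε ζ ω)) P := by
  have h := (hasGaussianLaw_path_noise hm n).map
    (LinearMap.toContinuousLinearMap (designMap k v ζ))
  refine h.congr (Filter.Eventually.of_forall fun ω => ?_)
  exact (designMap_apply k v f ε ζ ω).symm

omit [Fintype D] [IsProbabilityMeasure P] in
theorem memLp_path (hm : IsModel P k v f ε ξ) (p : D) : MemLp (fun ω => f ω p) 2 P :=
  (hm.path.gaussian.hasGaussianLaw_eval p).memLp_two

omit [Fintype D] [IsProbabilityMeasure P] in
theorem memLp_noise (hm : IsModel P k v f ε ξ) (n : ℕ) : MemLp (ε n) 2 P :=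
  (hm.noise_law n).hasGaussianLaw.memLp_two

omit [Fintype D] [IsProbabilityMeasure P] in
theorem memLp_fixedObs (hm : IsModel P k v f ε ξ) {n : ℕ} (ζ : Fin n → D) (j : Fin n) :
    MemLp (fun ω => fixedObs f ε ζ ω j) 2 P :=
  (memLp_path hm _).add (memLp_noise hm _)

omit [Fintype D] [IsProbabilityMeasure P] in
theorem memLp_postMean (hm : IsModel P k v f ε ξ) {n : ℕ} (ζ : Fin n → D) (p : D) :
    MemLp (fun ω => ∑ l, gain k v ζ p l * fixedObs f ε ζ ω l) 2 P :=
  memLp_finsetSum _ fun l _ => (memLp_fixedObs hm ζ l).const_mul _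

omit [Fintype D] [IsProbabilityMeasure P] in
theorem covariance_path_noise (hm : IsModel P k v f ε ξ) (p : D) (n : ℕ) :
    cov[fun ω => f ω p, ε n; P] = 0 := by
  have hg : Measurable fun x : (ℕ → ℝ) × (ℕ → ℝ) => x.1 n := by fun_prop
  exact (hm.path_indep.comp (measurable_pi_apply p) hg).covariance_eq_zero (memLp_path hm p)
    (memLp_noise hm n)

omit [Fintype D] [IsProbabilityMeasure P] in
theorem covariance_noise (hm : IsModel P k v f ε ξ) (i j : ℕ) :
    cov[ε i, ε j; P] = if i = j then (v : ℝ) else 0 := by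
  split_ifs with h
  · subst h
    rw [covariance_self (hm.noise_measurable i).aemeasurable, (hm.noise_law i).variance_eq,
      variance_id_gaussianReal]
  · exact (hm.noise_indep.indepFun h).covariance_eq_zero (memLp_noise hm i) (memLp_noise hm j)

omit [Fintype D] in
theorem covariance_path_fixedObs (hm : IsModel P k v f ε ξ) {n : ℕ} (ζ : Fin n → D) (p : D)
    (j : Fin n) : cov[fun ω => f ω p, fun ω => fixedObs f ε ζ ω j; P] = k p (ζ j) := by
  have h := covariance_add_right (memLp_path hm p) (memLp_path hm (ζ j)) (memLp_noise hm j)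
  rw [hm.path.covariance_eq, covariance_path_noise hm, add_zero] at h
  exact h

omit [Fintype D] in
theorem covariance_fixedObs (hm : IsModel P k v f ε ξ) {n : ℕ} (ζ : Fin n → D) (i j : Fin n) :
    cov[fun ω => fixedObs f ε ζ ω i, fun ω => fixedObs f ε ζ ω j; P] =
      k (ζ i) (ζ j) + if i = j then (v : ℝ) else 0 := by
  have h := covariance_add_left (memLp_path hm (ζ i)) (memLp_noise hm i) (memLp_fixedObs hm ζ j)
  have h2 := covariance_add_right (memLp_noise hm i) (memLp_path hm (ζ j)) (memLp_noise hm j)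
  rw [covariance_comm (ε i) (fun ω => f ω (ζ j)), covariance_path_noise hm, covariance_noise hm,
    zero_add] at h2
  rw [covariance_path_fixedObs hm] at h
  simp only [← Fin.ext_iff] at h2
  exact h.trans (by rw [← h2]; rfl)

omit [Fintype D] [MeasurableSpace Ω'] in
theorem residual_eq (p : D) {n : ℕ} (ζ : Fin n → D) :
    (fun ω => residual k v f ε ζ ω p) =
      (fun ω => f ω p) - fun ω => ∑ l, gain k v ζ p l * fixedObs f ε ζ ω l := by
  ext ω
  simp [residual, postMean_eq_sum]

omit [Fintype D] in
theorem covariance_residual_fixedObs (hk : (Matrix.of k).PosSemidef) (hv : 0 < v)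
    (hm : IsModel P k v f ε ξ) {n : ℕ} (ζ : Fin n → D) (p : D) (j : Fin n) :
    cov[fun ω => residual k v f ε ζ ω p, fun ω => fixedObs f ε ζ ω j; P] = 0 := by
  rw [residual_eq, covariance_sub_left (memLp_path hm p) (memLp_postMean hm ζ p)
    (memLp_fixedObs hm ζ j), covariance_path_fixedObs hm,
    covariance_fun_sum_left (fun l => (memLp_fixedObs hm ζ l).const_mul _) (memLp_fixedObs hm ζ j),
    ← sum_gain_mul hk (v := v) (by exact_mod_cast hv) ζ p j, ← Finset.sum_sub_distrib]
  refine Finset.sum_eq_zero fun l _ => ?_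
  rw [covariance_const_mul_left, covariance_fixedObs hm, sub_self]

omit [Fintype D] in
-- The posterior mean is a combination of observations, to which the residual is orthogonal, so the
-- variance equals the covariance of the residual with `f p`.
theorem variance_residual (hk : (Matrix.of k).PosSemidef) (hv : 0 < v)
    (hm : IsModel P k v f ε ξ) {n : ℕ} (ζ : Fin n → D) (p : D) :
    Var[fun ω => residual k v f ε ζ ω p; P] = postVar k v ζ p := by
  have hL : MemLp (fun ω => residual k v f ε ζ ω p) 2 P := by
    rw [residual_eq]
    exact (memLp_path hm p).sub (memLp_postMean hm ζ p)
  rw [← covariance_self hL.aemeasurable]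
  nth_rewrite 2 [residual_eq]
  rw [covariance_sub_right hL (memLp_path hm p) (memLp_postMean hm ζ p),
    covariance_fun_sum_right (fun l => (memLp_fixedObs hm ζ l).const_mul _) hL]
  simp only [covariance_const_mul_right, covariance_residual_fixedObs hk hv hm, mul_zero,
    Finset.sum_const_zero, sub_zero]
  rw [residual_eq, covariance_sub_left (memLp_path hm p) (memLp_postMean hm ζ p)
    (memLp_path hm p), hm.path.covariance_eq,
    covariance_fun_sum_left (fun l => (memLp_fixedObs hm ζ l).const_mul _) (memLp_path hm p),
    postVar_eq_sum]
  simp only [covariance_const_mul_left]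
  congr 1
  refine Finset.sum_congr rfl fun l _ => ?_
  rw [covariance_comm, covariance_path_fixedObs hm]

omit [Fintype D] in
theorem integral_residual (hm : IsModel P k v f ε ξ) {n : ℕ} (ζ : Fin n → D) (p : D) :
    ∫ ω, residual k v f ε ζ ω p ∂P = 0 := by
  have hp : ∀ q, Integrable (fun ω => f ω q) P := fun q => (memLp_path hm q).integrable one_le_two
  have he : ∀ i, Integrable (ε i) P := fun i => (memLp_noise hm i).integrable one_le_two
  have hε : ∀ i, ∫ ω, ε i ω ∂P = 0 := fun i => by
    rw [(hm.noise_law i).integral_eq, integral_id_gaussianReal]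
  have ho : ∀ i, Integrable (fun ω => fixedObs f ε ζ ω i) P := fun i =>
    (memLp_fixedObs hm ζ i).integrable one_le_two
  simp only [residual, postMean_eq_sum]
  rw [integral_sub (hp p) (integrable_finsetSum _ fun l _ => (ho l).const_mul _),
    hm.path.mean_zero, integral_finsetSum _ fun l _ => (ho l).const_mul _]
  simp only [integral_const_mul, fixedObs]
  simp [integral_add (hp _) (he _), hm.path.mean_zero, hε]

theorem map_residual (hk : (Matrix.of k).PosSemidef) (hv : 0 < v) (hm : IsModel P k v f ε ξ)
    {n : ℕ} (ζ : Fin n → D) (p : D) :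
    P.map (fun ω => residual k v f ε ζ ω p) = gaussianReal 0 (postVar k v ζ p).toNNReal := by
  rw [((hasGaussianLaw_residual_fixedObs hm ζ).fst.eval p).map_eq_gaussianReal,
    integral_residual hm, variance_residual hk hv hm]

/-- For jointly Gaussian vectors zero covariance means independence. This replaces any computation
of a conditional law. -/
theorem indepFun_residual_fixedObs (hk : (Matrix.of k).PosSemidef) (hv : 0 < v)
    (hm : IsModel P k v f ε ξ) {n : ℕ} (ζ : Fin n → D) :
    IndepFun (residual k v f ε ζ) (fixedObs f ε ζ) P :=
  (hasGaussianLaw_residual_fixedObs hm ζ).indepFun_of_covariance_eval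
    (X := fun p ω => residual k v f ε ζ ω p) (Y := fun j ω => fixedObs f ε ζ ω j)
    fun p j => covariance_residual_fixedObs hk hv hm ζ p j

omit [Fintype D] in
theorem indepFun_path_noise_chi (hm : IsModel P k v f ε ξ) :
    IndepFun (fun ω => (f ω, fun n => ε n ω)) (fun ω n => ξ n ω) P :=
  indepFun_prodMk_left hm.path.measurable (measurable_pi_lambda _ hm.noise_measurable)
    (measurable_pi_lambda _ hm.chi_measurable) hm.path_indep hm.noise_chi_indep

omit [Fintype D] [IsProbabilityMeasure P] in
theorem indepFun_chi_past (hm : IsModel P k v f ε ξ) (n : ℕ) :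
    IndepFun (fun ω (i : Fin n) => ξ i ω) (ξ n) P := by
  have h := hm.chi_indep.indepFun_finset (Finset.range n) {n} (by simp) hm.chi_measurable
  have h1 : Measurable fun x : Finset.range n → ℝ =>
    fun i : Fin n => x ⟨i, Finset.mem_range.2 i.2⟩ := by fun_prop
  have h2 : Measurable fun x : ({n} : Finset ℕ) → ℝ => x ⟨n, Finset.mem_singleton_self n⟩ := by
    fun_prop
  exact h.comp h1 h2

omit [Fintype D] in
theorem indepFun_design_chi (hm : IsModel P k v f ε ξ) {n : ℕ} (ζ : Fin n → D) :
    IndepFun (fun ω => (residual k v f ε ζ ω, fixedObs f ε ζ ω))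
      (fun ω => ((fun i : Fin n => ξ i ω), ξ n ω)) P := by
  have hφ : Measurable fun x : (D → ℝ) × (ℕ → ℝ) =>
      designMap k v ζ (x.1, fun i : Fin n => x.2 i) := by
    simp only [designMap, LinearMap.coe_mk, AddHom.coe_mk]
    fun_prop
  have hξ : Measurable fun x : ℕ → ℝ => ((fun i : Fin n => x i), x n) := by fun_prop
  simp only [designMap_apply]
  exact (indepFun_path_noise_chi hm).comp hφ hξ

omit [Fintype D] in
theorem indepFun_past_chi (hm : IsModel P k v f ε ξ) {n : ℕ} (ζ : Fin n → D) :
    IndepFun (fun ω => (fixedObs f ε ζ ω, fun i : Fin n => ξ i ω)) (ξ n) P := by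
  refine indepFun_prodMk_left (measurable_fixedObs hm ζ)
    (measurable_pi_lambda _ fun i => hm.chi_measurable i) (hm.chi_measurable n) ?_
    (indepFun_chi_past hm n)
  exact (indepFun_design_chi (k := k) hm ζ).comp measurable_snd measurable_id

theorem indepFun_past_residual (hk : (Matrix.of k).PosSemidef) (hv : 0 < v)
    (hm : IsModel P k v f ε ξ) {n : ℕ} (ζ : Fin n → D) :
    IndepFun (fun ω => ((fixedObs f ε ζ ω, fun i : Fin n => ξ i ω), ξ n ω))
      (residual k v f ε ζ) P := by
  have hξm : Measurable fun ω => ((fun i : Fin n => ξ i ω), ξ n ω) :=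
    (measurable_pi_lambda _ fun i : Fin n => hm.chi_measurable i).prodMk (hm.chi_measurable n)
  have h2 := indepFun_prodMk_right (measurable_residual hm ζ) (measurable_fixedObs hm ζ) hξm
    (indepFun_design_chi hm ζ)    (indepFun_residual_fixedObs hk hv hm ζ)
  exact h2.symm.comp (φ := fun x => ((x.1, x.2.1), x.2.2)) (by fun_prop) measurable_id

/-- The residuals lie in the credible box of radius `√(2 log |D| + s)` posterior deviations with
probability at least `1 - exp (-s / 2)`. -/
theorem map_residual_compl_box_le [Nonempty D] (hk : (Matrix.of k).PosSemidef) (hv : 0 < v)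
    (hm : IsModel P k v f ε ξ) {n : ℕ} (ζ : Fin n → D) (s : ℝ) :
    P.map (residual k v f ε ζ) {r | ∀ p, |r p| ≤
      √(2 * Real.log (Fintype.card D) + s) * postSd k v ζ p}ᶜ ≤
      ENNReal.ofReal (Real.exp (-s / 2)) := by
  set b := 2 * Real.log (Fintype.card D) + s
  have hN : (0 : ℝ) < Fintype.card D := by exact_mod_cast Fintype.card_pos
  have hp : ∀ p, P.map (residual k v f ε ζ) {r | √b * postSd k v ζ p < |r p|} ≤
      ENNReal.ofReal (Real.exp (-b / 2)) := by
    intro p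
    have h := gaussianReal_tail_le (postVar k v ζ p).toNNReal b
    have hr : Measurable fun ω => residual k v f ε ζ ω p :=
      (measurable_pi_apply p).comp (measurable_residual hm ζ)
    have hs : MeasurableSet {r : ℝ | √b * √(postVar k v ζ p) < |r|} :=
      measurableSet_lt measurable_const continuous_abs.measurable
    rw [← map_residual hk hv hm ζ p,
      Real.coe_toNNReal _ (postVar_nonneg hk (NNReal.coe_pos.2 hv) ζ p),
      Measure.map_apply hr hs] at h
    exact (Measure.map_apply (measurable_residual hm ζ)
      (hs.preimage (measurable_pi_apply p))).trans_le h
  calc _ ≤ P.map (residual k v f ε ζ) (⋃ p, {r | √b * postSd k v ζ p < |r p|}) := by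
        refine measure_mono fun r hr => ?_
        simpa using hr
    _ ≤ ∑ p, P.map (residual k v f ε ζ) {r | √b * postSd k v ζ p < |r p|} :=
        measure_iUnion_fintype_le _ _
    _ ≤ ∑ _p : D, ENNReal.ofReal (Real.exp (-b / 2)) := Finset.sum_le_sum fun p _ => hp p
    -- The term `2 log |D|` in `b` cancels the factor `|D|` of the union bound.
    _ = ENNReal.ofReal (Real.exp (-s / 2)) := by
        rw [Finset.sum_const, Finset.card_univ, nsmul_eq_mul, ← ENNReal.ofReal_natCast,
          ← ENNReal.ofReal_mul hN.le]
        congr 1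
        rw [show -b / 2 = -Real.log (Fintype.card D) + -s / 2 by simp only [b]; ring, Real.exp_add,
          Real.exp_neg, Real.exp_log hN, mul_inv_cancel_left₀ hN.ne']

end FixedDesign

/-! ### The function class -/

section QFun

theorem IsClassH.nonneg {h : ℝ → ℝ} (hh : IsClassH h) {a : ℝ} (ha : 0 ≤ a) : 0 ≤ h a := by
  have := hh.monotone (Set.mem_Ici.2 le_rfl) (Set.mem_Ici.2 ha) ha
  rwa [hh.zero] at this

theorem IsClassH.measurable_comp {α : Type*} [MeasurableSpace α] {h : ℝ → ℝ} (hh : IsClassH h)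
    {u : α → ℝ} (hu : Measurable u) (hu0 : ∀ x, 0 ≤ u x) : Measurable fun x => h (u x) := by
  -- Nothing is known about `h` on negative numbers; clamping the argument at `0` gives a globally
  -- monotone, hence Borel, function.
  have hmono : Monotone fun a => h (max a 0) := fun a b hab =>
    hh.monotone (Set.mem_Ici.2 (le_max_right _ _)) (Set.mem_Ici.2 (le_max_right _ _))
       (max_le_max_right _ hab)
  have := hmono.measurable.comp hu
  simpa only [Function.comp_def, max_eq_left (hu0 _)] using this

/-- The argument of the `i`-th concave function in a `QFun`. -/
noncomputable def QFun.inner (q : QFun) (i : Fin q.n) (a : ℝ) : ℝ := ∑ j, q.lam i j * a ^ q.ν i j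

theorem QFun.inner_nonneg (q : QFun) (i : Fin q.n) {a : ℝ} (ha : 0 ≤ a) : 0 ≤ q.inner i a :=
  Finset.sum_nonneg fun j _ => mul_nonneg (q.lam_nonneg i j) (Real.rpow_nonneg ha _)

theorem QFun.measurable_inner (q : QFun) (i : Fin q.n) : Measurable (q.inner i) := by
  unfold QFun.inner
  fun_prop

theorem QFun.eval_nonneg (q : QFun) {a : ℝ} (ha : 0 ≤ a) : 0 ≤ q.eval a :=
  Finset.sum_nonneg fun i _ => mul_nonneg (q.ζ_nonneg i) ((q.h_mem i).nonneg (q.inner_nonneg i ha))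

theorem QFun.measurable_eval_comp {α : Type*} [MeasurableSpace α] (q : QFun) {u : α → ℝ}
    (hu : Measurable u) (hu0 : ∀ x, 0 ≤ u x) : Measurable fun x => q.eval (u x) :=
  Finset.measurable_fun_sum _ fun i _ => ((q.h_mem i).measurable_comp
    ((q.measurable_inner i).comp hu) fun x => q.inner_nonneg i (hu0 x)).const_mul _

end QFun

/-! ### Deterministic bound on the simple regret -/

section Regret

variable {X W : Type*}

/-- Simple regret of the input `a` when the black-box function is `g`. -/
noncomputable def simpleRegret (ρ : (W → ℝ) → ℝ) (g : X × W → ℝ) (a : X) : ℝ :=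
  (⨆ a', ρ fun w' => g (a', w')) - ρ fun w' => g (a, w')

theorem simpleRegret_nonneg [Finite X] (ρ : (W → ℝ) → ℝ) (g : X × W → ℝ) (a : X) :
    0 ≤ simpleRegret ρ g a :=
  sub_nonneg.2 (le_ciSup (f := fun a' => ρ fun w' => g (a', w')) (Set.finite_range _).bddAbove a)

theorem measurable_simpleRegret [Finite X] [MeasurableSpace X] [DiscreteMeasurableSpace X]
    {ρ : (W → ℝ) → ℝ} (hρ : Measurable ρ) :
    Measurable fun p : (X × W → ℝ) × X => simpleRegret ρ p.1 p.2 := by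
  refine measurable_from_prod_countable_left fun a => ?_
  have h : ∀ a' : X, Measurable fun g : X × W → ℝ => ρ fun w' => g (a', w') := fun a' =>
    hρ.comp (by fun_prop)
  exact (Measurable.iSup h).sub (h a)

/-- If `ρ g` and `ρ m` lie between `lc` and `uc` for all inputs, the simple regret of the maximizer
`a` of `ρ m` is at most twice the width of the credible interval at the selected point. -/
theorem simpleRegret_le [Finite X] {ρ : (W → ℝ) → ℝ} {g : X × W → ℝ} {m : X → W → ℝ}
    {lc uc : X → ℝ} {a b : X} {Q : ℝ}
    (hg : ∀ a', lc a' ≤ ρ (fun w' => g (a', w')) ∧ ρ (fun w' => g (a', w')) ≤ uc a')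
    (hm : ∀ a', lc a' ≤ ρ (m a') ∧ ρ (m a') ≤ uc a')
    (ha : ∀ a', ρ (m a') ≤ ρ (m a))
    (hb : ∀ a', max (uc a' - ⨆ a, lc a) 0 ≤ max (uc b - ⨆ a, lc a) 0)
    (hbQ : uc b - lc b ≤ Q) (haQ : uc a - lc a ≤ Q) :
    simpleRegret ρ g a ≤ 2 * Q := by
  have : Nonempty X := ⟨a⟩
  -- The regret is split at `⨆ lc = lc a₀`. The optimum `a₁` exceeds it by at most the width at `b`,
  -- because `⨆ lc ≥ lc b`. From below, `lc a₀ ≤ ρ (m a₀) ≤ ρ (m a) ≤ uc a`, so it exceeds the value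
  -- at `a` by at most the width at `a`.
  obtain ⟨a₀, h₀⟩ := exists_eq_ciSup_of_finite (f := lc)
  obtain ⟨a₁, h₁⟩ := exists_eq_ciSup_of_finite (f := fun a' => ρ fun w' => g (a', w'))
  have hlb : lc b ≤ ⨆ a, lc a := le_ciSup (Set.finite_range _).bddAbove b
  have hwb : 0 ≤ uc b - lc b := by linarith [(hm b).1, (hm b).2]
  have e1 : uc a₁ - ⨆ a, lc a ≤ Q := by
    refine (le_max_left _ 0).trans ((hb a₁).trans (max_le ?_ ?_)) <;> linarith
  have e2 := (hg a₁).2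
  have e3 := (hm a₀).1
  have e4 := ha a₀
  have e5 := (hm a).2
  have e6 := (hg a).1
  rw [simpleRegret, ← h₁]
  linarith

end Regret

/-! ### Reduction of the adaptive design to fixed designs -/

section Algorithm

variable {X W Ω' : Type*} [Fintype X] [Nonempty X] [MeasurableSpace X] [DiscreteMeasurableSpace X]
  [Fintype W] [Nonempty W] [MeasurableSpace W] [DiscreteMeasurableSpace W]
  [MeasurableSpace Ω'] {P : Measure Ω'} [IsProbabilityMeasure P]
  {k : X × W → X × W → ℝ} {v : ℝ≥0} {ρ : (W → ℝ) → ℝ} {f : Ω' → X × W → ℝ} {ε ξ : ℕ → Ω' → ℝ}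
  {lcb ucb : ℕ → Ω' → X → ℝ} {xhat xtil x : ℕ → Ω' → X} {w : ℕ → Ω' → W} {q : QFun}

/-- The data of the first `m` rounds when the evaluated points are `ζ`, the observations `y.1` and
the chi-squared variables `y.2`. -/
noncomputable def designData {n : ℕ} (ζ : Fin n → X × W) {m : ℕ} (hmn : m ≤ n)
    (y : (Fin n → ℝ) × (Fin n → ℝ)) : Fin m → X × W × ℝ × ℝ :=
  fun j => ((ζ (Fin.castLE hmn j)).1, (ζ (Fin.castLE hmn j)).2, y.1 (Fin.castLE hmn j),
    beta X W (y.2 (Fin.castLE hmn j)))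

omit [Nonempty X] [Nonempty W] [DiscreteMeasurableSpace X] [DiscreteMeasurableSpace W] in
theorem measurable_designData {n : ℕ} (ζ : Fin n → X × W) {m : ℕ} (hmn : m ≤ n) :
    Measurable (designData ζ hmn) := by
  unfold designData beta
  fun_prop

omit [Nonempty X] [Nonempty W] [MeasurableSpace X] [DiscreteMeasurableSpace X]
  [MeasurableSpace W] [DiscreteMeasurableSpace W] [MeasurableSpace Ω'] in
theorem data_eq_designData {n : ℕ} (ζ : Fin n → X × W) {m : ℕ} (hmn : m ≤ n) (ω : Ω')
    (h : ∀ j : Fin m, (x j ω, w j ω) = ζ (Fin.castLE hmn j)) :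
    (fun j : Fin m => (x j ω, w j ω, obs f ε x w j ω, beta X W (ξ j ω))) =
      designData ζ hmn (fixedObs f ε ζ ω, fun i : Fin n => ξ i ω) := by
  funext j
  have hj := h j
  simp only [designData, fixedObs, obs, ← hj, Fin.val_castLE]

omit [Nonempty X] [Nonempty W] [MeasurableSpace Ω'] in
-- Doob–Dynkin factorization of the choices through the data and the current `β`.
theorem exists_policy [Nonempty (X × W)] (halg : IsRRGPUCB k v ρ f ε ξ lcb ucb xhat xtil x w)
    (n : ℕ) :
    ∃ Z : (Fin n → X × W × ℝ × ℝ) × ℝ → X × W, Measurable Z ∧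
      ∀ ω, (x n ω, w n ω) =
        Z ((fun j => (x j ω, w j ω, obs f ε x w j ω, beta X W (ξ j ω))), beta X W (ξ n ω)) := by
  have hz : Measurable[dataSigma f ε ξ x w n ⊔
      MeasurableSpace.comap (fun ω => beta X W (ξ n ω)) inferInstance]
      (fun ω => (x n ω, w n ω)) := (halg.x_measurable n).prodMk (halg.w_measurable n)
  rw [dataSigma, ← MeasurableSpace.comap_prodMk] at hz
  obtain ⟨Z, hZ, h⟩ := hz.exists_eq_measurable_comp
  exact ⟨Z, hZ, fun ω => congrFun h ω⟩

omit [Nonempty W] [MeasurableSpace Ω'] [DiscreteMeasurableSpace W] in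
theorem exists_recommendation (halg : IsRRGPUCB k v ρ f ε ξ lcb ucb xhat xtil x w) (n : ℕ) :
    ∃ Z : (Fin n → X × W × ℝ × ℝ) → X, Measurable Z ∧
      ∀ ω, xhat n ω = Z (fun j => (x j ω, w j ω, obs f ε x w j ω, beta X W (ξ j ω))) := by
  obtain ⟨Z, hZ, h⟩ := (halg.xhat_measurable n).exists_eq_measurable_comp
  exact ⟨Z, hZ, fun ω => congrFun h ω⟩

omit [MeasurableSpace Ω'] in
/-- That the first `n` evaluated points are `ζ` is determined by the observations at `ζ` and the
chi-squared variables. -/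
theorem exists_pts_eq_iff (halg : IsRRGPUCB k v ρ f ε ξ lcb ucb xhat xtil x w) {n : ℕ}
    (ζ : Fin n → X × W) :
    ∃ U : Set ((Fin n → ℝ) × (Fin n → ℝ)), MeasurableSet U ∧
      ∀ ω, pts x w n ω = ζ ↔ (fixedObs f ε ζ ω, fun i : Fin n => ξ i ω) ∈ U := by
  choose Z hZ hz using exists_policy halg
  -- `U` says that the policies, fed with the data belonging to `ζ`, reproduce `ζ` in every round.
  refine ⟨⋂ i : Fin n,
    {y | Z i (designData ζ i.2.le y, beta X W (y.2 i)) = ζ i}, ?_, fun ω => ?_⟩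
  · refine MeasurableSet.iInter fun i => ?_
    refine measurableSet_eq_fun ((hZ i).comp ((measurable_designData ζ i.2.le).prodMk ?_))
      measurable_const
    unfold beta
    fun_prop
  · simp only [Set.mem_iInter, Set.mem_ofPred_eq]
    constructor
    · intro h i
      have hpt : ∀ j : Fin n, (x j ω, w j ω) = ζ j := fun j => congrFun h j
      rw [← data_eq_designData (x := x) (w := w) ζ i.2.le ω fun j => hpt (Fin.castLE i.2.le j),
        ← hz i ω, hpt]
    · intro h
      -- As long as the earlier points agree with `ζ`, the replayed data are the actual data, so the
      -- next point agrees too.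
      have key : ∀ m (hm : m < n), (x m ω, w m ω) = ζ ⟨m, hm⟩ := by
        intro m
        induction m using Nat.strong_induction_on with
        | _ m ih =>
          intro hm
          rw [hz m ω, ← h ⟨m, hm⟩, data_eq_designData (x := x) (w := w) ζ hm.le ω
            fun j => ih j j.2 (j.2.trans hm)]
      funext i
      exact key i i.2

omit [IsProbabilityMeasure P] in
-- The measurability assumed of the algorithm refers to the σ-algebra generated by its own choices.
-- Replaying a fixed design breaks this circle.
theorem measurableSet_pts_eq (hmodel : IsModel P k v f ε ξ)
    (halg : IsRRGPUCB k v ρ f ε ξ lcb ucb xhat xtil x w) {n : ℕ} (ζ : Fin n → X × W) :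
    MeasurableSet {ω | pts x w n ω = ζ} := by
  obtain ⟨U, hU, h⟩ := exists_pts_eq_iff halg ζ
  have hY : Measurable fun ω => (fixedObs f ε ζ ω, fun i : Fin n => ξ i ω) :=
    (measurable_fixedObs hmodel ζ).prodMk
      (measurable_pi_lambda _ fun i : Fin n => hmodel.chi_measurable i)
  simp only [h]
  exact hY hU

omit [IsProbabilityMeasure P] in
theorem measurable_pts (hmodel : IsModel P k v f ε ξ)
    (halg : IsRRGPUCB k v ρ f ε ξ lcb ucb xhat xtil x w) (n : ℕ) : Measurable (pts x w n) :=
  measurable_to_countable' fun ζ => measurableSet_pts_eq hmodel halg ζ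

omit [IsProbabilityMeasure P] in
theorem measurable_point (hmodel : IsModel P k v f ε ξ)
    (halg : IsRRGPUCB k v ρ f ε ξ lcb ucb xhat xtil x w) (n : ℕ) :
    Measurable fun ω => (x n ω, w n ω) :=
  (measurable_pi_apply (Fin.last n)).comp (measurable_pts hmodel halg (n + 1))

omit [IsProbabilityMeasure P] in
theorem measurable_xhat (hmodel : IsModel P k v f ε ξ)
    (halg : IsRRGPUCB k v ρ f ε ξ lcb ucb xhat xtil x w) (n : ℕ) : Measurable (xhat n) := by
  obtain ⟨Z, hZ, h⟩ := exists_recommendation halg n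
  have hx : ∀ j, Measurable (x j) := fun j =>
    measurable_fst.comp (measurable_point hmodel halg j)
  have hw : ∀ j, Measurable (w j) := fun j =>
    measurable_snd.comp (measurable_point hmodel halg j)
  have hobs : ∀ j, Measurable (obs f ε x w j) := fun j => by
    have h1 : Measurable fun p : (X × W → ℝ) × (X × W) => p.1 p.2 :=
      measurable_from_prod_countable_left fun z => measurable_pi_apply z
    exact (h1.comp (hmodel.path.measurable.prodMk (measurable_point hmodel halg j))).add
      (hmodel.noise_measurable j)
  have hβ : ∀ j, Measurable fun ω => beta X W (ξ j ω) := fun j =>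
    measurable_const.add (hmodel.chi_measurable j)
  rw [funext h]
  exact hZ.comp (measurable_pi_lambda _ fun j =>
    (hx j).prodMk ((hw j).prodMk ((hobs j).prodMk (hβ j))))

/-- The width parameter `2 β^{1/2} σ (x_n, w_n)` of round `n`. -/
noncomputable def roundWidth (k : X × W → X × W → ℝ) (v : ℝ≥0) (ξ : ℕ → Ω' → ℝ)
    (x : ℕ → Ω' → X) (w : ℕ → Ω' → W) (n : ℕ) (ω : Ω') : ℝ :=
  2 * √(beta X W (ξ n ω)) * sd k v x w n ω (x n ω) (w n ω)

omit [Nonempty X] [MeasurableSpace X] [DiscreteMeasurableSpace X]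
  [Nonempty W] [MeasurableSpace W] [DiscreteMeasurableSpace W] [MeasurableSpace Ω'] in
theorem roundWidth_nonneg (n : ℕ) (ω : Ω') : 0 ≤ roundWidth k v ξ x w n ω :=
  mul_nonneg (by positivity) (Real.sqrt_nonneg _)

omit [IsProbabilityMeasure P] in
theorem measurable_sd_point (hmodel : IsModel P k v f ε ξ)
    (halg : IsRRGPUCB k v ρ f ε ξ lcb ucb xhat xtil x w) (n : ℕ) :
    Measurable fun ω => sd k v x w n ω (x n ω) (w n ω) := by
  have h : Measurable fun p : (Fin n → X × W) × (X × W) => postSd k (v : ℝ) p.1 p.2 :=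
    measurable_of_countable _
  exact h.comp ((measurable_pts hmodel halg n).prodMk (measurable_point hmodel halg n))

omit [IsProbabilityMeasure P] in
theorem measurable_roundWidth (hmodel : IsModel P k v f ε ξ)
    (halg : IsRRGPUCB k v ρ f ε ξ lcb ucb xhat xtil x w) (n : ℕ) :
    Measurable (roundWidth k v ξ x w n) := by
  have hβ : Measurable fun ω => beta X W (ξ n ω) :=
    measurable_const.add (hmodel.chi_measurable n)
  exact (hβ.sqrt.const_mul 2).mul (measurable_sd_point hmodel halg n)

omit [Nonempty X] [IsProbabilityMeasure P] [DiscreteMeasurableSpace X]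
  [DiscreteMeasurableSpace W] in
/-- Every function in the credible box of round `n` has regret at most `2 q (2 β^{1/2} σ)`. -/
theorem ae_simpleRegret_le (halg : IsRRGPUCB k v ρ f ε ξ lcb ucb xhat xtil x w)
    (hcred : CredibleBounds P k v ρ f ε ξ lcb ucb x w) (hq : WidthBound P k v ξ lcb ucb x w q)
    (n : ℕ) :
    ∀ᵐ ω ∂P, ∀ g : X × W → ℝ, (∀ p, |g p - mu k v f ε x w n ω p.1 p.2| ≤
      √(beta X W (ξ n ω)) * sd k v x w n ω p.1 p.2) →
      simpleRegret ρ g (xhat n ω) ≤ 2 * q.eval (roundWidth k v ξ x w n ω) := by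
  filter_upwards [hcred n, hq n] with ω hc hw g hg
  have hsd : ∀ a b, 0 ≤ sd k v x w n ω a b := fun a b => Real.sqrt_nonneg _
  have hsup : ⨆ w', sd k v x w n ω (x n ω) w' = sd k v x w n ω (x n ω) (w n ω) :=
    le_antisymm (ciSup_le fun w' => (pow_le_pow_iff_left₀ (hsd _ _) (hsd _ _) two_ne_zero).1
      (halg.w_argmax n ω w')) (le_ciSup (f := fun w' => sd k v x w n ω (x n ω) w')
        (Set.finite_range _).bddAbove (w n ω))
  rw [hsup] at hw
  refine simpleRegret_le (lc := lcb n ω) (uc := ucb n ω) (m := mu k v f ε x w n ω) (b := xtil n ω)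
    (fun a' => hc a' _ fun w' => ?_) (fun a' => hc a' _ fun w' => ?_) (halg.xhat_argmax n ω)
    (halg.xtil_argmax n ω) ((halg.x_ge_xtil n ω).trans hw) ((halg.x_ge_xhat n ω).trans hw)
  · have := abs_le.1 (hg (a', w'))
    simp only [Set.mem_Icc] at this ⊢
    constructor <;> linarith [this.1, this.2]
  -- The posterior mean is the centre of its own credible box.
  · have := mul_nonneg (Real.sqrt_nonneg (beta X W (ξ n ω))) (hsd a' w')
    simp only [Set.mem_Icc]
    constructor <;> linarith

/-- The expected regret of round `n` is at most the expected value of `2 q (2 β^{1/2} σ)`. -/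
theorem lintegral_simpleRegret_le (hk : (Matrix.of k).PosSemidef) (hv : 0 < v) (hρ : Measurable ρ)
    (hmodel : IsModel P k v f ε ξ) (halg : IsRRGPUCB k v ρ f ε ξ lcb ucb xhat xtil x w)
    (hcred : CredibleBounds P k v ρ f ε ξ lcb ucb x w) (hq : WidthBound P k v ξ lcb ucb x w q)
    (n : ℕ) :
    ∫⁻ ω, ENNReal.ofReal (simpleRegret ρ (f ω) (xhat n ω)) ∂P ≤
      ∫⁻ ω, ENNReal.ofReal (2 * q.eval (roundWidth k v ξ x w n ω)) ∂P := by
  have hsplit : ∀ F : Ω' → ENNReal,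
      ∫⁻ ω, F ω ∂P = ∑ ζ : Fin n → X × W, ∫⁻ ω in {ω | pts x w n ω = ζ}, F ω ∂P := by
    intro F
    have hun : (⋃ ζ : Fin n → X × W, {ω | pts x w n ω = ζ}) = Set.univ :=
      Set.eq_univ_of_forall fun ω => Set.mem_iUnion.2 ⟨pts x w n ω, rfl⟩
    rw [← setLIntegral_univ, ← hun, lintegral_iUnion (measurableSet_pts_eq hmodel halg),
      tsum_fintype]
    exact fun ζ ζ' hne => Set.disjoint_left.2 fun ω h h' => hne (h.symm.trans h')
  rw [hsplit, hsplit fun ω => ENNReal.ofReal (2 * q.eval (roundWidth k v ξ x w n ω))]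
  refine Finset.sum_le_sum fun ζ _ => ?_
  obtain ⟨U, hU, hUiff⟩ := exists_pts_eq_iff halg ζ
  obtain ⟨Z, hZ, hz⟩ := exists_policy halg n
  obtain ⟨V, hV, hxhat⟩ := exists_recommendation halg n
  have hY : Measurable fun ω => (fixedObs f ε ζ ω, fun i : Fin n => ξ i ω) :=
    (measurable_fixedObs hmodel ζ).prodMk
      (measurable_pi_lambda _ fun i : Fin n => hmodel.chi_measurable i)
  set Y : Ω' → (Fin n → ℝ) × (Fin n → ℝ) := fun ω => (fixedObs f ε ζ ω, fun i : Fin n => ξ i ω)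
  have hset : {ω | pts x w n ω = ζ} = Y ⁻¹' U := Set.ext hUiff
  have hdata : ∀ ω, Y ω ∈ U → (fun j : Fin n => (x j ω, w j ω, obs f ε x w j ω,
      beta X W (ξ j ω))) = designData ζ le_rfl (Y ω) := fun ω hω =>
    data_eq_designData ζ le_rfl ω fun j => congrFun ((hUiff ω).2 hω) j
  have hmean : Measurable fun y : Fin n → ℝ => fun p => postMean k (v : ℝ) ζ y p := by
    refine measurable_pi_lambda _ fun p => ?_
    simp only [postMean_eq_sum]
    fun_prop
  have hβ : Measurable (beta X W) := measurable_const.add measurable_id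
  have hwid : Measurable fun y : ((Fin n → ℝ) × (Fin n → ℝ)) × ℝ => 2 * √(beta X W y.2) *
      postSd k (v : ℝ) ζ (Z (designData ζ le_rfl y.1, beta X W y.2)) := by
    refine ((hβ.comp measurable_snd).sqrt.const_mul 2).mul
      ((measurable_of_countable fun p => postSd k (v : ℝ) ζ p).comp (hZ.comp ?_))
    exact ((measurable_designData ζ le_rfl).comp measurable_fst).prodMk (hβ.comp measurable_snd)
  have hwid0 : ∀ y : ((Fin n → ℝ) × (Fin n → ℝ)) × ℝ, 0 ≤ 2 * √(beta X W y.2) *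
      postSd k (v : ℝ) ζ (Z (designData ζ le_rfl y.1, beta X W y.2)) := fun y =>
    mul_nonneg (by positivity) (Real.sqrt_nonneg _)
  have hmu : ∀ ω, Y ω ∈ U → ∀ p : X × W,
      mu k v f ε x w n ω p.1 p.2 = postMean k (v : ℝ) ζ (fixedObs f ε ζ ω) p := by
    intro ω hω p
    have hp : pts x w n ω = ζ := (hUiff ω).2 hω
    have ho : (fun i : Fin n => obs f ε x w i ω) = fixedObs f ε ζ ω := by
      funext i
      rw [← hp]
      rfl
    rw [mu, ho, hp]
  have hsd : ∀ ω, Y ω ∈ U → ∀ a b, sd k v x w n ω a b = postSd k (v : ℝ) ζ (a, b) := by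
    intro ω hω a b
    rw [sd, (hUiff ω).2 hω]
  have hrw : ∀ ω, Y ω ∈ U → roundWidth k v ξ x w n ω = 2 * √(beta X W (ξ n ω)) *
      postSd k (v : ℝ) ζ (Z (designData ζ le_rfl (Y ω), beta X W (ξ n ω))) := by
    intro ω hω
    rw [roundWidth, hsd ω hω, hz ω, hdata ω hω]
  -- On `pts = ζ` the sample path is posterior mean plus residual, so the regret is a function of
  -- past and residual, while the width is a function of past and current `ξ n`.
  have main := setLIntegral_le_of_credible (P := P) (Y := Y) (R := residual k v f ε ζ) (S := ξ n)
    (B := fun s => {r | ∀ p, |r p| ≤ √(beta X W s) * postSd k v ζ p})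
    (Δ := fun y => simpleRegret ρ (fun p => postMean k (v : ℝ) ζ y.1.1 p + y.2 p)
      (V (designData ζ le_rfl y.1)))
    (G := fun y => 2 * q.eval (2 * √(beta X W y.2) *
      postSd k (v : ℝ) ζ (Z (designData ζ le_rfl y.1, beta X W y.2)))) (U := U)
    hY (measurable_residual hmodel ζ) (hmodel.chi_measurable n) (hmodel.chi_law n).map_eq
    (indepFun_past_chi hmodel ζ) (indepFun_past_residual hk hv hmodel ζ)
    ?_ (fun s => map_residual_compl_box_le hk hv hmodel ζ s) ?_
    (fun _ => simpleRegret_nonneg _ _ _) ((q.measurable_eval_comp hwid hwid0).const_mul 2)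
    (fun y => mul_nonneg zero_le_two (q.eval_nonneg (hwid0 y))) hU ?_
  · rw [hset]
    refine le_trans (le_of_eq ?_) (main.trans (le_of_eq ?_))
    · refine setLIntegral_congr_fun (hY hU) fun ω hω => ?_
      have hf : f ω = fun p => postMean k (v : ℝ) ζ (Y ω).1 p + residual k v f ε ζ ω p := by
        funext p
        simp [Y, residual]
      dsimp only
      rw [← hf, hxhat ω, hdata ω hω]
    · refine setLIntegral_congr_fun (hY hU) fun ω hω => ?_
      dsimp only
      rw [hrw ω hω]
  · have hbox : {y : ℝ × (X × W → ℝ) | y.2 ∈ {r : X × W → ℝ | ∀ p, |r p| ≤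
          √(beta X W y.1) * postSd k (v : ℝ) ζ p}} =
        ⋂ p, {y | |y.2 p| ≤ √(beta X W y.1) * postSd k (v : ℝ) ζ p} := by
      ext y
      simp
    rw [hbox]
    refine MeasurableSet.iInter fun p =>
      measurableSet_le (f := fun y : ℝ × (X × W → ℝ) => |y.2 p|) ?_ ?_
    · exact continuous_abs.measurable.comp ((measurable_pi_apply p).comp measurable_snd)
    · exact (hβ.comp measurable_fst).sqrt.mul_const _
  · have hpath : Measurable fun y : ((Fin n → ℝ) × (Fin n → ℝ)) × (X × W → ℝ) =>
        fun p => postMean k (v : ℝ) ζ y.1.1 p + y.2 p := by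
      refine measurable_pi_lambda _ fun p => Measurable.add ?_ ?_
      · exact (measurable_pi_apply p).comp (hmean.comp (measurable_fst.comp measurable_fst))
      · exact (measurable_pi_apply p).comp measurable_snd
    exact (measurable_simpleRegret hρ).comp
      (hpath.prodMk (hV.comp ((measurable_designData ζ le_rfl).comp measurable_fst)))
  · filter_upwards [ae_simpleRegret_le halg hcred hq n] with ω h hω r hr
    rw [← hdata ω hω, ← hxhat ω]
    have hrwω := hrw ω hω
    rw [← hdata ω hω] at hrwω
    rw [← hrwω]
    refine h _ fun p => ?_
    rw [hmu ω hω, hsd ω hω, add_sub_cancel_left]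
    exact hr p

end Algorithm

/-! ### Jensen and Hölder inequalities -/

section Jensen

variable {Ω' : Type*} [MeasurableSpace Ω'] {P : Measure Ω'} [IsProbabilityMeasure P] {h : ℝ → ℝ}

/-- The slope comes from the right derivative of the convex function `-h`. The point must be
interior: at `0` a function such as the square root has no supporting line. -/
theorem IsClassH.exists_support_line (hh : IsClassH h) {m : ℝ} (hm : 0 < m) :
    ∃ c, ∀ a, 0 ≤ a → h a ≤ h m + c * (a - m) := by
  have hconv : ConvexOn ℝ (Set.Ici 0) (-h) := hh.concave.neg
  have hint : m ∈ interior (Set.Ici (0 : ℝ)) := by simpa using hm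
  refine ⟨-derivWithin (-h) (Set.Ioi m) m, fun a ha => ?_⟩
  rcases lt_trichotomy a m with ham | rfl | ham
  · have h1 := (hconv.slope_le_leftDeriv_of_mem_interior ha hint ham).trans
      (hconv.leftDeriv_le_rightDeriv_of_mem_interior hint)
    rw [slope_def_field, div_le_iff₀ (sub_pos.2 ham)] at h1
    simp only [Pi.neg_apply] at h1
    linarith
  · simp
  · have h1 := hconv.rightDeriv_le_slope_of_mem_interior hint ha ham
    rw [slope_def_field, le_div_iff₀ (sub_pos.2 ham)] at h1
    simp only [Pi.neg_apply] at h1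
    linarith

theorem IsClassH.integrable_comp (hh : IsClassH h) {u : Ω' → ℝ} (hum : Measurable u)
    (hu0 : ∀ ω, 0 ≤ u ω) (hu : Integrable u P) : Integrable (fun ω => h (u ω)) P := by
  obtain ⟨c, hc⟩ := hh.exists_support_line one_pos
  have hg : Integrable (fun ω => h 1 + c * (u ω - 1)) P :=
    (integrable_const _).add ((hu.sub (integrable_const _)).const_mul c)
  refine hg.mono' (hh.measurable_comp hum hu0).aestronglyMeasurable (ae_of_all _ fun ω => ?_)
  rw [Real.norm_of_nonneg (hh.nonneg (hu0 ω))]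
  exact hc _ (hu0 ω)

/-- Jensen's inequality for the average over `n < t` and the expectation. -/
theorem IsClassH.sum_integral_le (hh : IsClassH h) {u : ℕ → Ω' → ℝ} (hum : ∀ n, Measurable (u n))
    (hu0 : ∀ n ω, 0 ≤ u n ω) (hu : ∀ n, Integrable (u n) P) {t : ℕ} (ht : 1 ≤ t) :
    ∑ n ∈ Finset.range t, ∫ ω, h (u n ω) ∂P ≤
      t * h (1 / (t : ℝ) * ∑ n ∈ Finset.range t, ∫ ω, u n ω ∂P) := by
  have ht0 : (0 : ℝ) < t := by exact_mod_cast ht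
  have hI0 : ∀ n, 0 ≤ ∫ ω, u n ω ∂P := fun n => integral_nonneg (hu0 n)
  set m := 1 / (t : ℝ) * ∑ n ∈ Finset.range t, ∫ ω, u n ω ∂P with hm
  have hm0 : 0 ≤ m := mul_nonneg (by positivity) (Finset.sum_nonneg fun n _ => hI0 n)
  -- If the average is `0`, there may be no supporting line, but then every `u n` vanishes almost
  -- surely and `h 0 = 0` suffices.
  rcases hm0.eq_or_lt with hz | hpos
  · have hs : ∑ n ∈ Finset.range t, ∫ ω, u n ω ∂P = 0 := by
      rw [hm] at hz
      rcases mul_eq_zero.1 hz.symm with h1 | h1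
      · exact absurd h1 (by positivity)
      · exact h1
    have hzero : ∀ n ∈ Finset.range t, ∫ ω, h (u n ω) ∂P = 0 := by
      intro n hn
      have h1 := (Finset.sum_eq_zero_iff_of_nonneg fun n _ => hI0 n).1 hs n hn
      have h2 := (integral_eq_zero_iff_of_nonneg (hu0 n) (hu n)).1 h1
      refine integral_eq_zero_of_ae ?_
      filter_upwards [h2] with ω hω
      simp only [Pi.zero_apply] at hω ⊢
      rw [hω, hh.zero]
    rw [Finset.sum_eq_zero hzero]
    exact mul_nonneg ht0.le (hh.nonneg hm0)
  · obtain ⟨c, hc⟩ := hh.exists_support_line hpos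
    have hn : ∀ n, ∫ ω, h (u n ω) ∂P ≤ h m + c * (∫ ω, u n ω ∂P - m) := by
      intro n
      have hg : Integrable (fun ω => c * (u n ω - m)) P :=
        ((hu n).sub (integrable_const m)).const_mul c
      calc ∫ ω, h (u n ω) ∂P ≤ ∫ ω, (h m + c * (u n ω - m)) ∂P :=
            integral_mono (hh.integrable_comp (hum n) (hu0 n) (hu n))
              ((integrable_const _).add hg) fun ω => hc _ (hu0 n ω)
        _ = _ := by
            rw [integral_add (integrable_const _) hg, integral_const_mul,
              integral_sub (hu n) (integrable_const m)]
            simp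
    have hsum : ∑ n ∈ Finset.range t, ∫ ω, u n ω ∂P = t * m := by
      rw [hm]
      field_simp
    calc _ ≤ ∑ n ∈ Finset.range t, (h m + c * (∫ ω, u n ω ∂P - m)) :=
          Finset.sum_le_sum fun n _ => hn n
      _ = t * h m := by
          rw [Finset.sum_add_distrib, ← Finset.mul_sum, Finset.sum_sub_distrib, hsum]
          simp

theorem isClassH_rpow {p : ℝ} (hp0 : 0 < p) (hp1 : p ≤ 1) : IsClassH fun a => a ^ p where
  monotone := Real.monotoneOn_rpow_Ici_of_exponent_nonneg hp0.le
  concave := Real.concaveOn_rpow hp0.le hp1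
  zero := Real.zero_rpow hp0.ne'

/-- Hölder's inequality with exponents `1 / (1 - θ)` and `1 / θ`. -/
theorem sum_rpow_mul_rpow_le {ι : Type*} (s : Finset ι) {a b : ι → ℝ} (ha : ∀ i, 0 ≤ a i)
    (hb : ∀ i, 0 ≤ b i) {θ : ℝ} (hθ0 : 0 < θ) (hθ1 : θ < 1) :
    ∑ i ∈ s, a i ^ (1 - θ) * b i ^ θ ≤ (∑ i ∈ s, a i) ^ (1 - θ) * (∑ i ∈ s, b i) ^ θ := by
  have hθ' : 1 - θ ≠ 0 := by linarith
  have hpq : (1 - θ)⁻¹.HolderConjugate θ⁻¹ := by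
    rw [Real.holderConjugate_iff]
    refine ⟨(one_lt_inv₀ (by linarith)).2 (by linarith), ?_⟩
    rw [inv_inv, inv_inv]
    ring
  have h := Real.inner_le_Lp_mul_Lq_of_nonneg s hpq (f := fun i => a i ^ (1 - θ))
    (g := fun i => b i ^ θ) (fun i _ => Real.rpow_nonneg (ha i) _)
    (fun i _ => Real.rpow_nonneg (hb i) _)
  simp only [one_div, inv_inv] at h
  refine h.trans (le_of_eq ?_)
  congr 2 <;> refine Finset.sum_congr rfl fun i _ => ?_
  · rw [← Real.rpow_mul (ha i), mul_inv_cancel₀ hθ', Real.rpow_one]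
  · rw [← Real.rpow_mul (hb i), mul_inv_cancel₀ hθ0.ne', Real.rpow_one]

end Jensen

/-! ### Moments of the random confidence parameter -/

section Moments

theorem integrable_exp_mul_chiSquared {r : ℝ} (hr : r < 1 / 2) :
    Integrable (fun s => Real.exp (r * s)) (chiSquared 2) := by
  rw [chiSquared_two, expMeasure, gammaMeasure, integrable_withDensity_iff_integrable_smul'
    (f := gammaPDF 1 (1 / 2)) (measurable_gammaPDFReal 1 (1 / 2)).ennreal_ofReal (ae_of_all _ fun _ => ENNReal.ofReal_lt_top)]
  have h1 : IntegrableOn (fun s => 1 / 2 * Real.exp (-(1 / 2 - r) * s)) (Set.Ici 0) volume :=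
    ((integrableOn_Ici_iff_integrableOn_Ioi (by simp)).2
      (exp_neg_integrableOn_Ioi 0 (by linarith : 0 < 1 / 2 - r))).const_mul _
  rw [← integrable_indicator_iff measurableSet_Ici] at h1
  refine h1.congr (ae_of_all _ fun s => ?_)
  by_cases hs : 0 ≤ s
  · simp only [Set.indicator_of_mem (Set.mem_Ici.2 hs), gammaPDF,
      gammaPDFReal, if_pos hs,
      Real.rpow_one, Real.Gamma_one, sub_self, Real.rpow_zero, smul_eq_mul, div_one, mul_one]
    rw [ENNReal.toReal_ofReal (by positivity), mul_assoc, ← Real.exp_add]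
    congr 2
    ring
  · simp [gammaPDF, gammaPDFReal, hs]

theorem ae_beta_nonneg (X W : Type*) [Fintype X] [Fintype W] :
    ∀ᵐ s ∂chiSquared 2, 0 ≤ beta X W s := by
  have h : chiSquared 2 (Set.Iic 0) = 0 := by
    have := chiSquared_two_Iic one_pos le_rfl
    simpa using this
  rw [measure_eq_zero_iff_ae_notMem] at h
  filter_upwards [h] with s hs
  have hs' : 0 < s := not_le.1 hs
  have hlog : 0 ≤ Real.log (Fintype.card (X × W) : ℝ) := Real.log_natCast_nonneg _
  rw [beta]
  linarith

theorem integrable_beta_rpow (X W : Type*) [Fintype X] [Fintype W] {p : ℝ} (hp : 0 ≤ p) :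
    Integrable (fun s => beta X W s ^ p) (chiSquared 2) := by
  have h : ∀ r : ℝ, r < 1 / 2 →
      Integrable (fun s => Real.exp (r * beta X W s)) (chiSquared 2) := by
    intro r hr
    simp only [beta, mul_add, Real.exp_add]
    exact (integrable_exp_mul_chiSquared hr).const_mul _
  -- Any `t` in `(0, 1/2)` would do: exponential moments at both `t` and `-t` dominate every power.
  refine (integrable_rpow_abs_of_integrable_exp_mul (t := 1 / 4) (by norm_num) (h _ (by norm_num))
    (h _ (by norm_num)) hp).congr ?_
  filter_upwards [ae_beta_nonneg X W] with s hs
  rw [abs_of_nonneg hs]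

end Moments

/-! ### Summing the rounds -/

section Bound

variable {X W Ω' : Type*} {k : X × W → X × W → ℝ} {v : ℝ≥0} {ξ : ℕ → Ω' → ℝ} {x : ℕ → Ω' → X}
  {w : ℕ → Ω' → W}

theorem sd_sq (hk : (Matrix.of k).PosSemidef) (hv : 0 < v) (n : ℕ) (ω : Ω') (a : X) (b : W) :
    sd k v x w n ω a b ^ 2 = postVar k (v : ℝ) (pts x w n ω) (a, b) :=
  Real.sq_sqrt (postVar_nonneg hk (NNReal.coe_pos.2 hv) _ _)

theorem sd_le_one (hk : (Matrix.of k).PosSemidef) (hk_le : ∀ z, k z z ≤ 1) (hv : 0 < v) (n : ℕ)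
    (ω : Ω') (a : X) (b : W) : sd k v x w n ω a b ≤ 1 :=
  Real.sqrt_le_one.2 ((postVar_le hk (NNReal.coe_pos.2 hv) _ _).trans (hk_le _))

section Finite

variable [Fintype X] [Fintype W] [MeasurableSpace Ω'] {P : Measure Ω'} {f : Ω' → X × W → ℝ}
  {ε : ℕ → Ω' → ℝ}

theorem measurable_beta : Measurable (beta X W) := measurable_const.add measurable_id

theorem integrable_beta_noise (hmodel : IsModel P k v f ε ξ) {p : ℝ} (hp : 0 ≤ p) (n : ℕ) :
    Integrable (fun ω => beta X W (ξ n ω) ^ p) P := by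
  have h := integrable_beta_rpow X W hp
  rw [← (hmodel.chi_law n).map_eq] at h
  exact h.comp_measurable (hmodel.chi_measurable n)

theorem integral_beta_noise (hmodel : IsModel P k v f ε ξ) {ν : ℝ} (n : ℕ) :
    ∫ ω, beta X W (ξ n ω) ^ (ν / (2 - nuPrime ν)) ∂P = constC2 X W ν :=
  (hmodel.chi_law n).integral_comp
    (measurable_beta.pow_const (ν / (2 - nuPrime ν))).aestronglyMeasurable

theorem ae_beta_noise_nonneg (hmodel : IsModel P k v f ε ξ) :
    ∀ᵐ ω ∂P, ∀ n, 0 ≤ beta X W (ξ n ω) := by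
  refine ae_all_iff.2 fun n => ?_
  have h := ae_beta_nonneg X W
  rw [← (hmodel.chi_law n).map_eq] at h
  exact ae_of_ae_map (hmodel.chi_measurable n).aemeasurable h

omit [MeasurableSpace Ω'] in
theorem sum_sd_sq_le (hk : (Matrix.of k).PosSemidef) (hk_le : ∀ z, k z z ≤ 1) (hv : 0 < v) (t : ℕ)
    (ω : Ω') :
    ∑ n ∈ Finset.range t, sd k v x w n ω (x n ω) (w n ω) ^ 2 ≤
      constC1 v * maxInfoGain k (v : ℝ) t := by
  simp only [sd_sq hk hv]
  exact sum_postVar_le hk hk_le hv (fun n => (x n ω, w n ω)) t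

omit [MeasurableSpace Ω'] in
-- The exponents fit Hölder with `θ = ν' / 2`, since `ν / (2 - ν') * (1 - ν' / 2) = ν / 2`.
-- Posterior deviations are at most `1`, so `σ ^ ν ≤ σ ^ ν'`; this keeps `θ < 1` when `ν` is large.
theorem roundWidth_rpow_le (hk : (Matrix.of k).PosSemidef) (hk_le : ∀ z, k z z ≤ 1) (hv : 0 < v)
    {ν : ℝ} (hν : 0 < ν) (n : ℕ) (ω : Ω') (hβ : 0 ≤ beta X W (ξ n ω)) :
    roundWidth k v ξ x w n ω ^ ν ≤
      2 ^ ν * ((beta X W (ξ n ω) ^ (ν / (2 - nuPrime ν))) ^ (1 - nuPrime ν / 2) *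
        (sd k v x w n ω (x n ω) (w n ω) ^ 2) ^ (nuPrime ν / 2)) := by
  have h1 : nuPrime ν ≤ 1 := min_le_right _ _
  have h0 : 0 < nuPrime ν := lt_min hν one_pos
  have hsd : 0 ≤ sd k v x w n ω (x n ω) (w n ω) := Real.sqrt_nonneg _
  rw [roundWidth, Real.mul_rpow (by positivity) hsd, Real.mul_rpow zero_le_two (Real.sqrt_nonneg _),
    mul_assoc]
  gcongr ?_ * (?_ * ?_)
  · rw [Real.sqrt_eq_rpow, ← Real.rpow_mul hβ, ← Real.rpow_mul hβ]
    refine le_of_eq ?_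
    congr 1
    have : (2 - nuPrime ν) ≠ 0 := by linarith
    field_simp
  · rw [← Real.rpow_natCast, ← Real.rpow_mul hsd]
    refine (Real.rpow_le_rpow_of_exponent_ge' hsd (sd_le_one hk hk_le hv _ _ _ _) h0.le
      (min_le_left _ _)).trans (le_of_eq ?_)
    congr 1
    push_cast
    ring

theorem constC1_mul_maxInfoGain_nonneg [Nonempty X] [Nonempty W] (hk : (Matrix.of k).PosSemidef) (hk_le : ∀ z, k z z ≤ 1)
    (hv : 0 < v) (t : ℕ) : 0 ≤ constC1 v * maxInfoGain k (v : ℝ) t :=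
  (Finset.sum_nonneg fun _ _ => postVar_nonneg hk (NNReal.coe_pos.2 hv) _ _).trans
    (sum_postVar_le hk hk_le hv (fun _ => Classical.arbitrary _) t)

end Finite

variable [Fintype X] [Nonempty X] [MeasurableSpace X] [DiscreteMeasurableSpace X]
  [Fintype W] [Nonempty W] [MeasurableSpace W] [DiscreteMeasurableSpace W]
  [MeasurableSpace Ω'] {P : Measure Ω'} [IsProbabilityMeasure P]
  {ρ : (W → ℝ) → ℝ} {f : Ω' → X × W → ℝ} {ε : ℕ → Ω' → ℝ}
  {lcb ucb : ℕ → Ω' → X → ℝ} {xhat xtil : ℕ → Ω' → X} {q : QFun}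

omit [IsProbabilityMeasure P] in
theorem integrable_roundWidth_rpow (hk : (Matrix.of k).PosSemidef) (hk_le : ∀ z, k z z ≤ 1)
    (hv : 0 < v) (hmodel : IsModel P k v f ε ξ)
    (halg : IsRRGPUCB k v ρ f ε ξ lcb ucb xhat xtil x w) {ν : ℝ} (hν : 0 < ν) (n : ℕ) :
    Integrable (fun ω => roundWidth k v ξ x w n ω ^ ν) P := by
  refine ((integrable_beta_noise (X := X) (W := W) hmodel (half_pos hν).le n).const_mul
    (2 ^ ν)).mono' ((measurable_roundWidth hmodel halg n).pow_const ν).aestronglyMeasurable ?_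
  filter_upwards [ae_beta_noise_nonneg (X := X) (W := W) hmodel] with ω hω
  have hsd : 0 ≤ sd k v x w n ω (x n ω) (w n ω) := Real.sqrt_nonneg _
  rw [Real.norm_of_nonneg (Real.rpow_nonneg (roundWidth_nonneg n ω) _), roundWidth,
    Real.mul_rpow (by positivity) hsd, Real.mul_rpow zero_le_two (Real.sqrt_nonneg _),
    Real.sqrt_eq_rpow, ← Real.rpow_mul (hω n), one_div_mul_eq_div]
  exact mul_le_of_le_one_right (mul_nonneg (by positivity) (Real.rpow_nonneg (hω n) _))
    (Real.rpow_le_one hsd (sd_le_one hk hk_le hv _ _ _ _) hν.le)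

/-- Hölder is applied path by path, because the sum of the variances has the deterministic bound
`Γ`. Only then does Jensen handle the concave power `1 - θ` of the sum of the `β` terms. -/
theorem sum_integral_roundWidth_rpow_le (hk : (Matrix.of k).PosSemidef) (hk_le : ∀ z, k z z ≤ 1)
    (hv : 0 < v) (hmodel : IsModel P k v f ε ξ)
    (halg : IsRRGPUCB k v ρ f ε ξ lcb ucb xhat xtil x w) {ν : ℝ} (hν : 0 < ν) (t : ℕ) :
    ∑ n ∈ Finset.range t, ∫ ω, roundWidth k v ξ x w n ω ^ ν ∂P ≤
      2 ^ ν * ((t * constC2 X W ν) ^ (1 - nuPrime ν / 2) *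
        (constC1 v * maxInfoGain k (v : ℝ) t) ^ (nuPrime ν / 2)) := by
  have h1 : nuPrime ν ≤ 1 := min_le_right _ _
  have h0 : 0 < nuPrime ν := lt_min hν one_pos
  set θ := nuPrime ν / 2 with hθ
  set Γ := constC1 v * maxInfoGain k (v : ℝ) t
  have hΓ : 0 ≤ Γ := constC1_mul_maxInfoGain_nonneg hk hk_le hv t
  set κ := ν / (2 - nuPrime ν) with hκ
  have hκ0 : 0 ≤ κ := div_nonneg hν.le (by linarith)
  -- `β` is nonnegative only almost surely; absolute values make `S` nonnegative everywhere, as the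
  -- Jensen lemma requires.
  let S : Ω' → ℝ := fun ω => ∑ n ∈ Finset.range t, |beta X W (ξ n ω)| ^ κ
  have hβm : ∀ n, Measurable fun ω => beta X W (ξ n ω) := fun n =>
    measurable_beta.comp (hmodel.chi_measurable n)
  have hS0 : ∀ ω, 0 ≤ S ω := fun ω => Finset.sum_nonneg fun n _ => by positivity
  have hSm : Measurable S := Finset.measurable_fun_sum _ fun n _ =>
    (continuous_abs.measurable.comp (hβm n)).pow_const κ
  have habs : ∀ n, (fun ω => |beta X W (ξ n ω)| ^ κ) =ᵐ[P] fun ω => beta X W (ξ n ω) ^ κ := by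
    intro n
    filter_upwards [ae_beta_noise_nonneg (X := X) (W := W) hmodel] with ω hω
    rw [abs_of_nonneg (hω n)]
  have hint : ∀ n, Integrable (fun ω => |beta X W (ξ n ω)| ^ κ) P := fun n =>
    (integrable_beta_noise hmodel hκ0 n).congr (habs n).symm
  have hSi : Integrable S P := integrable_finsetSum _ fun n _ => hint n
  have hSE : ∫ ω, S ω ∂P = t * constC2 X W ν := by
    rw [integral_finsetSum _ fun n _ => hint n, Finset.sum_congr rfl fun n _ =>
      (integral_congr_ae (habs n)).trans (integral_beta_noise hmodel n)]
    simp
  have hcl := isClassH_rpow (p := 1 - θ) (by linarith) (by linarith)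
  -- Taking `t = 1` leaves Jensen's inequality for the single variable `S`.
  have hJ := hcl.sum_integral_le (P := P) (u := fun _ => S) (fun _ => hSm) (fun _ => hS0)
    (fun _ => hSi) (t := 1) le_rfl
  simp only [Finset.sum_range_one, Nat.cast_one, div_one, one_mul, hSE] at hJ
  rw [← integral_finsetSum _ fun n _ => integrable_roundWidth_rpow hk hk_le hv hmodel halg hν n]
  calc _ ≤ ∫ ω, 2 ^ ν * (S ω ^ (1 - θ) * Γ ^ θ) ∂P := by
        refine integral_mono_ae (integrable_finsetSum _ fun n _ =>
          integrable_roundWidth_rpow hk hk_le hv hmodel halg hν n)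
          (((hcl.integrable_comp hSm hS0 hSi).mul_const _).const_mul _) ?_
        filter_upwards [ae_beta_noise_nonneg (X := X) (W := W) hmodel] with ω hω
        refine (Finset.sum_le_sum fun n _ =>
          roundWidth_rpow_le hk hk_le hv hν n ω (hω n)).trans ?_
        rw [← Finset.mul_sum]
        gcongr
        have hS : S ω = ∑ n ∈ Finset.range t, beta X W (ξ n ω) ^ κ :=
          Finset.sum_congr rfl fun n _ => by rw [abs_of_nonneg (hω n)]
        refine (sum_rpow_mul_rpow_le _ (fun n => Real.rpow_nonneg (hω n) _)
          (fun n => sq_nonneg _) (half_pos h0) (by linarith)).trans ?_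
        rw [hS]
        refine mul_le_mul_of_nonneg_left ?_ (Real.rpow_nonneg (hS ▸ hS0 ω) _)
        exact Real.rpow_le_rpow (Finset.sum_nonneg fun n _ => sq_nonneg _)
          (sum_sd_sq_le hk hk_le hv t ω) (half_pos h0).le
    _ = 2 ^ ν * ((∫ ω, S ω ^ (1 - θ) ∂P) * Γ ^ θ) := by
        rw [integral_const_mul, integral_mul_const]
    _ ≤ _ := by gcongr

omit [IsProbabilityMeasure P] in
theorem integrable_inner_roundWidth (hk : (Matrix.of k).PosSemidef) (hk_le : ∀ z, k z z ≤ 1)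
    (hv : 0 < v) (hmodel : IsModel P k v f ε ξ)
    (halg : IsRRGPUCB k v ρ f ε ξ lcb ucb xhat xtil x w) (q : QFun) (i : Fin q.n) (n : ℕ) :
    Integrable (fun ω => q.inner i (roundWidth k v ξ x w n ω)) P :=
  integrable_finsetSum _ fun j _ =>
    (integrable_roundWidth_rpow hk hk_le hv hmodel halg (q.ν_pos i j) n).const_mul _

omit [IsProbabilityMeasure P] in
theorem measurable_inner_roundWidth (hmodel : IsModel P k v f ε ξ)
    (halg : IsRRGPUCB k v ρ f ε ξ lcb ucb xhat xtil x w) (q : QFun) (i : Fin q.n) (n : ℕ) :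
    Measurable fun ω => q.inner i (roundWidth k v ξ x w n ω) :=
  (q.measurable_inner i).comp (measurable_roundWidth hmodel halg n)

theorem integrable_eval_roundWidth (hk : (Matrix.of k).PosSemidef) (hk_le : ∀ z, k z z ≤ 1)
    (hv : 0 < v) (hmodel : IsModel P k v f ε ξ)
    (halg : IsRRGPUCB k v ρ f ε ξ lcb ucb xhat xtil x w) (q : QFun) (n : ℕ) :
    Integrable (fun ω => q.eval (roundWidth k v ξ x w n ω)) P :=
  integrable_finsetSum _ fun i _ => ((q.h_mem i).integrable_comp
    (measurable_inner_roundWidth hmodel halg q i n)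
    (fun ω => q.inner_nonneg i (roundWidth_nonneg n ω))
    (integrable_inner_roundWidth hk hk_le hv hmodel halg q i n)).const_mul _

theorem sum_integral_eval_roundWidth_le (hk : (Matrix.of k).PosSemidef) (hk_le : ∀ z, k z z ≤ 1)
    (hv : 0 < v) (hmodel : IsModel P k v f ε ξ)
    (halg : IsRRGPUCB k v ρ f ε ξ lcb ucb xhat xtil x w) (q : QFun) {t : ℕ} (ht : 1 ≤ t) :
    ∑ n ∈ Finset.range t, ∫ ω, q.eval (roundWidth k v ξ x w n ω) ∂P ≤
      t * ∑ i, q.ζ i * q.h i ((1 / (t : ℝ)) * ∑ j,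
        2 ^ q.ν i j * q.lam i j * ((t : ℝ) * constC2 X W (q.ν i j)) ^ (1 - nuPrime (q.ν i j) / 2) *
          (constC1 v * maxInfoGain k (v : ℝ) t) ^ (nuPrime (q.ν i j) / 2)) := by
  have hin0 : ∀ i n ω, 0 ≤ q.inner i (roundWidth k v ξ x w n ω) := fun i n ω =>
    q.inner_nonneg i (roundWidth_nonneg n ω)
  have hi := fun i n => integrable_inner_roundWidth hk hk_le hv hmodel halg q i n
  have hm := fun i n => measurable_inner_roundWidth hmodel halg q i n
  have hexp : ∀ n, ∫ ω, q.eval (roundWidth k v ξ x w n ω) ∂P =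
      ∑ i, q.ζ i * ∫ ω, q.h i (q.inner i (roundWidth k v ξ x w n ω)) ∂P := by
    intro n
    simp only [← integral_const_mul]
    exact integral_finsetSum _ fun i _ =>
      ((q.h_mem i).integrable_comp (hm i n) (hin0 i n) (hi i n)).const_mul _
  simp only [hexp]
  rw [Finset.sum_comm, Finset.mul_sum]
  refine Finset.sum_le_sum fun i _ => ?_
  rw [← Finset.mul_sum, mul_left_comm]
  refine mul_le_mul_of_nonneg_left ?_ (q.ζ_nonneg i)
  refine ((q.h_mem i).sum_integral_le (hm i) (hin0 i) (hi i) ht).trans ?_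
  have hle : ∑ n ∈ Finset.range t, ∫ ω, q.inner i (roundWidth k v ξ x w n ω) ∂P ≤
      ∑ j, 2 ^ q.ν i j * q.lam i j *
        ((t : ℝ) * constC2 X W (q.ν i j)) ^ (1 - nuPrime (q.ν i j) / 2) *
          (constC1 v * maxInfoGain k (v : ℝ) t) ^ (nuPrime (q.ν i j) / 2) := by
    have hexp' : ∀ n, ∫ ω, q.inner i (roundWidth k v ξ x w n ω) ∂P =
        ∑ j, q.lam i j * ∫ ω, roundWidth k v ξ x w n ω ^ q.ν i j ∂P := by
      intro n
      simp only [← integral_const_mul]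
      exact integral_finsetSum _ fun j _ =>
        (integrable_roundWidth_rpow hk hk_le hv hmodel halg (q.ν_pos i j) n).const_mul _
    simp only [hexp']
    rw [Finset.sum_comm]
    refine Finset.sum_le_sum fun j _ => ?_
    rw [← Finset.mul_sum]
    refine (mul_le_mul_of_nonneg_left (sum_integral_roundWidth_rpow_le hk hk_le hv hmodel halg
      (q.ν_pos i j) t) (q.lam_nonneg i j)).trans (le_of_eq ?_)
    ring
  have hnn : 0 ≤ ∑ n ∈ Finset.range t, ∫ ω, q.inner i (roundWidth k v ξ x w n ω) ∂P :=
    Finset.sum_nonneg fun n _ => integral_nonneg (hin0 i n)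
  have hinv : (0 : ℝ) ≤ 1 / (t : ℝ) := by positivity
  refine mul_le_mul_of_nonneg_left ((q.h_mem i).monotone ?_ ?_
    (mul_le_mul_of_nonneg_left hle hinv)) (Nat.cast_nonneg t)
  · exact mul_nonneg hinv hnn
  · exact mul_nonneg hinv (hnn.trans hle)

/-- The comparison of lower integrals has a finite right side, so it yields integrability of the
regret together with the bound on its mean. -/
theorem integrable_simpleRegret_and_integral_le (hk : (Matrix.of k).PosSemidef)
    (hk_le : ∀ z, k z z ≤ 1) (hv : 0 < v) (hρ : Measurable ρ)
    (hmodel : IsModel P k v f ε ξ) (halg : IsRRGPUCB k v ρ f ε ξ lcb ucb xhat xtil x w)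
    (hcred : CredibleBounds P k v ρ f ε ξ lcb ucb x w) (hq : WidthBound P k v ξ lcb ucb x w q)
    (n : ℕ) :
    Integrable (fun ω => simpleRegret ρ (f ω) (xhat n ω)) P ∧
      ∫ ω, simpleRegret ρ (f ω) (xhat n ω) ∂P ≤
        2 * ∫ ω, q.eval (roundWidth k v ξ x w n ω) ∂P := by
  have hm : Measurable fun ω => simpleRegret ρ (f ω) (xhat n ω) :=
    (measurable_simpleRegret hρ).comp (hmodel.path.measurable.prodMk
      (measurable_xhat hmodel halg n))
  have hnn : ∀ ω, 0 ≤ simpleRegret ρ (f ω) (xhat n ω) := fun ω => simpleRegret_nonneg _ _ _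
  have hE : Integrable (fun ω => 2 * q.eval (roundWidth k v ξ x w n ω)) P :=
    (integrable_eval_roundWidth hk hk_le hv hmodel halg q n).const_mul 2
  have hEnn : ∀ ω, 0 ≤ 2 * q.eval (roundWidth k v ξ x w n ω) := fun ω =>
    mul_nonneg zero_le_two (q.eval_nonneg (roundWidth_nonneg n ω))
  have hle := lintegral_simpleRegret_le hk hv hρ hmodel halg hcred hq n
  rw [← ofReal_integral_eq_lintegral_ofReal hE (ae_of_all _ hEnn)] at hle
  have hI : Integrable (fun ω => simpleRegret ρ (f ω) (xhat n ω)) P :=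
    ⟨hm.aestronglyMeasurable, (hasFiniteIntegral_iff_ofReal (ae_of_all _ hnn)).2
      (hle.trans_lt ENNReal.ofReal_lt_top)⟩
  refine ⟨hI, ?_⟩
  rw [← ofReal_integral_eq_lintegral_ofReal hI (ae_of_all _ hnn),
    ENNReal.ofReal_le_ofReal_iff (integral_nonneg hEnn), integral_const_mul] at hle
  exact hle

end Bound

end RRGPUCB

/-! ### The cumulative regret bound -/

theorem mainTheorem1
    {X W Ω' : Type*}
    [Fintype X] [Nonempty X] [MeasurableSpace X] [DiscreteMeasurableSpace X]
    [Fintype W] [Nonempty W] [MeasurableSpace W] [DiscreteMeasurableSpace W]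
    [MeasurableSpace Ω'] (P : Measure Ω') [IsProbabilityMeasure P]
    (k : X × W → X × W → ℝ) (hk : (Matrix.of k).PosSemidef) (hk_le : ∀ z, k z z ≤ 1)
    (v : ℝ≥0) (hv : 0 < v)
    (ρ : (W → ℝ) → ℝ) (hρ : Measurable ρ)
    (f : Ω' → X × W → ℝ) (ε ξ : ℕ → Ω' → ℝ)
    (hmodel : RRGPUCB.IsModel P k v f ε ξ)
    (lcb ucb : ℕ → Ω' → X → ℝ) (xhat xtil x : ℕ → Ω' → X) (w : ℕ → Ω' → W)
    (halg : RRGPUCB.IsRRGPUCB k v ρ f ε ξ lcb ucb xhat xtil x w)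
    (hcred : RRGPUCB.CredibleBounds P k v ρ f ε ξ lcb ucb x w)
    (q : RRGPUCB.QFun) (hq : RRGPUCB.WidthBound P k v ξ lcb ucb x w q)
    (t : ℕ) (ht : 1 ≤ t) :
    Integrable (RRGPUCB.cumRegret ρ f xhat t) P ∧
    ∫ ω, RRGPUCB.cumRegret ρ f xhat t ω ∂P ≤
      2 * (t : ℝ) * ∑ i, q.ζ i * q.h i ((1 / (t : ℝ)) * ∑ j,
        2 ^ q.ν i j * q.lam i j *
          ((t : ℝ) * RRGPUCB.constC2 X W (q.ν i j)) ^ (1 - RRGPUCB.nuPrime (q.ν i j) / 2) *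
          (RRGPUCB.constC1 v * RRGPUCB.maxInfoGain k (v : ℝ) t) ^
            (RRGPUCB.nuPrime (q.ν i j) / 2)) := by
  have h := RRGPUCB.integrable_simpleRegret_and_integral_le hk hk_le hv hρ hmodel halg hcred hq
  refine ⟨integrable_finsetSum _ fun n _ => (h n).1, ?_⟩
  calc ∫ ω, RRGPUCB.cumRegret ρ f xhat t ω ∂P
      = ∑ n ∈ Finset.range t, ∫ ω, RRGPUCB.simpleRegret ρ (f ω) (xhat n ω) ∂P :=
        integral_finsetSum _ fun n _ => (h n).1
    _ ≤ ∑ n ∈ Finset.range t, 2 * ∫ ω, q.eval (RRGPUCB.roundWidth k v ξ x w n ω) ∂P :=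
        Finset.sum_le_sum fun n _ => (h n).2
    _ ≤ _ := by
        rw [← Finset.mul_sum, mul_assoc]
        exact mul_le_mul_of_nonneg_left
          (RRGPUCB.sum_integral_eval_roundWidth_le hk hk_le hv hmodel halg q ht) zero_le_two
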